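/- Let $1/2<H<1$, $T>0$, $x_0\in\mathbb R$, let $B^H=(B^H_t)_{t\ge 0}$ be a fractional Brownian motion with Hurst index $H$ (centred Gaussian, $B^H_0=0$, $\mathbb E[B^H_tB^H_s]=\frac12(t^{2H}+s^{2H}-|t-s|^{2H})$, continuous paths), and let $h:\mathbb R\to\mathbb R$ be bounded and $C^\infty$. Let $X=(X_t)_{t\in[0,T]}$ be a process with continuous paths solving $$\mathrm dX_t=h(X_t)\circ \mathrm dB^H_t,\qquad X_0=x_0,$$ i.e. almost surely $X_t=x_0+\int_0^t h(X_s)\circ \mathrm dB^H_s$ for all $t\in[0,T]$, where $\circ\,\mathrm dB^H$ is the symmetric pathwise integral: the limit of the sums $\sum_i\frac12\big(h(X_{s_i})+h(X_{s_{i+1}})\big)\big(B^H_{s_{i+1}}-B^H_{s_i}\big)$ as the mesh of the partition of $[0,t]$ tends to $0$. Consider the equation $$\partial_t p(x,t)=-\partial_x\big\{Ht^{2H-1}h'(x)h(x)\,p(x,t)\big\}+\partial_x^2\big\{Ht^{2H-1}h(x)^2\,p(x,t)\big\},\qquad p(x,0)=\delta(x-x_0).\tag{$*$}$$ 1. The laws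 of $X_t$ satisfy $(*)$ weakly: for every $\varphi\in C_c^\infty(\mathbb R)$ and $0<t<T$, $$\frac{\mathrm d}{\mathrm dt}\mathbb E[\varphi(X_t)]=\mathbb E\big[Ht^{2H-1}h'(X_t)h(X_t)\varphi'(X_t)+Ht^{2H-1}h(X_t)^2\varphi''(X_t)\big],$$ the law of $X_0$ is $\delta_{x_0}$, and the law of $X_t$ converges weakly to $\delta_{x_0}$ as $t\downarrow0$. 2. Suppose $h(x_0)\ne0$, let $I$ be the maximal interval containing $x_0$ on which $h$ does not vanish (so $I=\mathbb R$ if $h$ has no zero), put $\hat x(x)=\int_{x_0}^x\frac{1}{h(y)}\,\mathrm dy$ for $x\in I$, and let $$p(x,t)=C_1\frac{1}{\sqrt{\frac12t^{2H}h(x)^2}}\exp\Big\{-\frac{\hat x(x)^2}{2t^{2H}}\Big\}\quad(x\in I),\qquad p(x,t)=0\quad(x\notin I),$$ with $C_1=\frac1{2\sqrt\pi}$. Then $\int_{\mathbb R}p(x,t)\,\mathrm dx=1$ for all $t>0$; for every $t\in(0,T]$ the random variable $X_t$ has probability density $p(\cdot,t)$; for every $t>0$ the function $p(\cdot,t)$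 is $C^2$ on $\mathbb R$ and $p$ satisfies the equation in $(*)$ at every $x\in\mathbb R$, $t>0$; and $p(x,t)\,\mathrm dx\to\delta_{x_0}$ weakly as $t\downarrow0$. -/

import Mathlib

open MeasureTheory ProbabilityTheory Set Filter Topology
open scoped ContDiff NNReal BoundedContinuousFunction

/-- `(B t)_{t ≥ 0}` is a fractional Brownian motion with Hurst index `H` under `P`: a centred
Gaussian process started at `0` with covariance `(t^{2H} + s^{2H} - |t - s|^{2H}) / 2`, taken with
continuous sample paths. (Only the values `B t` with `t ≥ 0` are relevant.) -/
structure IsFractionalBrownianMotion {Ω : Type*} [MeasurableSpace Ω] (H : ℝ)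
    (B : ℝ → Ω → ℝ) (P : Measure Ω) : Prop where
  gaussian : IsGaussianProcess (fun t : ℝ≥0 => B (t : ℝ)) P
  zero : ∀ᵐ w ∂P, B 0 w = 0
  mean : ∀ t : ℝ, 0 ≤ t → ∫ w, B t w ∂P = 0
  covariance : ∀ s t : ℝ, 0 ≤ s → 0 ≤ t →
    ∫ w, B t w * B s w ∂P = 1 / 2 * (t ^ (2 * H) + s ^ (2 * H) - |t - s| ^ (2 * H))
  continuous_paths : ∀ᵐ w ∂P, ContinuousOn (fun t => B t w) (Ici 0)

/-- `s 0 ≤ s 1 ≤ ... ≤ s n` is a partition of `[a, b]` whose mesh is smaller than `δ`. -/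
structure IsPartition (a b δ : ℝ) (n : ℕ) (s : ℕ → ℝ) : Prop where
  left : s 0 = a
  right : s n = b
  mono : ∀ i < n, s i ≤ s (i + 1)
  mesh : ∀ i < n, s (i + 1) - s i < δ

/-- The symmetric (trapezoidal) Riemann sum of `∫ y ∘ dz` along the points `s 0, ..., s n`. -/
noncomputable def symmetricSum (y z : ℝ → ℝ) (n : ℕ) (s : ℕ → ℝ) : ℝ :=
  ∑ i ∈ Finset.range n, (y (s i) + y (s (i + 1))) / 2 * (z (s (i + 1)) - z (s i))

/-- The symmetric pathwise integral `∫_a^b y ∘ dz` exists and equals `I`: the symmetric Riemann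
sums converge to `I` as the mesh of the partition tends to `0`. -/
def HasSymmetricIntegral (y z : ℝ → ℝ) (a b I : ℝ) : Prop :=
  ∀ ε > 0, ∃ δ > 0, ∀ (n : ℕ) (s : ℕ → ℝ), IsPartition a b δ n s →
    |symmetricSum y z n s - I| < ε

/-- `X = (X_t)_{t ∈ [0,T]}` solves `dX_t = h(X_t) ∘ dB_t`, `X_0 = x₀`: it is a process with
continuous paths such that, almost surely, `X_t = x₀ + ∫_0^t h(X_s) ∘ dB_s` for all `t ∈ [0,T]`. -/
structure IsSymmetricSDESolution {Ω : Type*} [MeasurableSpace Ω] (P : Measure Ω)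
    (B : ℝ → Ω → ℝ) (h : ℝ → ℝ) (x₀ T : ℝ) (X : ℝ → Ω → ℝ) : Prop where
  aemeasurable : ∀ t ∈ Icc 0 T, AEMeasurable (X t) P
  continuous_paths : ∀ᵐ w ∂P, ContinuousOn (fun t => X t w) (Icc 0 T)
  initial : ∀ᵐ w ∂P, X 0 w = x₀
  equation : ∀ᵐ w ∂P, ∀ t ∈ Icc 0 T,
    HasSymmetricIntegral (fun s => h (X s w)) (fun s => B s w) 0 t (X t w - x₀)

/-- The family of probability laws `(μ t)_{0 ≤ t ≤ T}` satisfies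
`∂_t μ = -∂_x {H t^{2H-1} h' h μ} + ∂_x² {H t^{2H-1} h² μ}` on `(0,T) × ℝ` in the weak sense,
i.e. tested against smooth compactly supported functions of `x`. -/
def IsWeakPDEESolution (H : ℝ) (h : ℝ → ℝ) (T : ℝ) (μ : ℝ → Measure ℝ) : Prop :=
  ∀ φ : ℝ → ℝ, ContDiff ℝ ∞ φ → HasCompactSupport φ → ∀ t ∈ Ioo 0 T,
    HasDerivAt (fun s => ∫ x, φ x ∂(μ s))
      (∫ x, (H * t ^ (2 * H - 1) * (deriv h x * h x) * deriv φ x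
        + H * t ^ (2 * H - 1) * h x ^ 2 * iteratedDeriv 2 φ x) ∂(μ t)) t

/-- `p(x,t)` is a classical solution of
`∂_t p = -∂_x {H t^{2H-1} h' h p} + ∂_x² {H t^{2H-1} h² p}` for all `x ∈ ℝ`, `t > 0`. -/
def IsClassicalPDEESolution (H : ℝ) (h : ℝ → ℝ) (p : ℝ → ℝ → ℝ) : Prop :=
  ∀ t > 0, ContDiff ℝ 2 (fun x => p x t) ∧ ∀ x : ℝ,
    HasDerivAt (fun s => p x s)
      (-deriv (fun y => H * t ^ (2 * H - 1) * (deriv h y * h y) * p y t) x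
        + iteratedDeriv 2 (fun y => H * t ^ (2 * H - 1) * h y ^ 2 * p y t) x) t

/-- The maximal interval around `x₀` on which `h` has no zero (all of `ℝ` if `h` never vanishes).
This is where `x ↦ ∫_{x₀}^x 1/h` makes sense. -/
def nonvanishingInterval (h : ℝ → ℝ) (x₀ : ℝ) : Set ℝ :=
  {x | ∀ y ∈ uIcc x₀ x, h y ≠ 0}

/-- `x̂(x) = ∫_{x₀}^x 1/h(y) dy`. -/
noncomputable def xHat (h : ℝ → ℝ) (x₀ x : ℝ) : ℝ := ∫ y in x₀..x, 1 / h y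

/-- `C₁ (t^{2H} h(x)² / 2)^{-1/2} exp(-x̂(x)² / (2 t^{2H}))` on the interval where `x̂` is defined,
and `0` elsewhere. -/
noncomputable def explicitDensity (C₁ H : ℝ) (h : ℝ → ℝ) (x₀ x t : ℝ) : ℝ :=
  (nonvanishingInterval h x₀).indicator
    (fun x => C₁ * (1 / √(1 / 2 * t ^ (2 * H) * h x ^ 2))
      * Real.exp (-(xHat h x₀ x ^ 2) / (2 * t ^ (2 * H)))) x

/-! ### Partitions and symmetric Riemann sums -/

/-! For `H > 1/2` the quadratic variation of `B` vanishes, so the symmetric integral obeys the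
ordinary chain rule and `X_t = Φ(B_t)`, where `Φ' = h ∘ Φ` and `Φ 0 = x₀`. Everything else is about
the image under `Φ` of a Gaussian of variance `t^{2H}`.

Pathwise representation. Where `h ≠ 0`, `Φ` is the inverse of `x̂`. Henstock's lemma
(`sum_abs_trapezoidDefect_le`) upgrades convergence of the sums to absolute summability of the local
errors; since an increment of `x̂(X)` differs from that of `B` by at most a constant times (squared
increment of `B` plus local error), `x̂(X) - B` is constant (`xHat_sub_xHat_eq`). A connectedness
argument makes this global (`eq_flow_of_ne_zero`) and shows that a path started at a zero of `h`
never moves (`eq_solutionMap`).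

Weak equation. With `f = φ ∘ Φ` and `Z` standard Gaussian, Stein's identity gives `d/dc E f(cZ) = c
E f''(cZ)`. Here `f'' = (h h' φ' + h² φ'') ∘ Φ`, and `c = t^H` produces the factor `H t^{2H-1}`.

Density. `x̂` maps the nonvanishing interval onto `ℝ`: `h` is bounded, and it vanishes at most
exponentially fast in `x̂` near a finite endpoint. Changing variables gives the explicit density.
The Gaussian factor beats every power of `1/h`, so the extension by zero is `C²`
(`hasDerivAt_densityTerm`), and the classical equation becomes an algebraic identity on the
interval. -/

theorem IsPartition.mono_mesh {a b δ δ' : ℝ} {n : ℕ} {s : ℕ → ℝ} (hs : IsPartition a b δ n s)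
    (h : δ ≤ δ') : IsPartition a b δ' n s :=
  ⟨hs.left, hs.right, hs.mono, fun i hi => (hs.mesh i hi).trans_le h⟩

theorem IsPartition.le_of_le {a b δ : ℝ} {n : ℕ} {s : ℕ → ℝ} (hs : IsPartition a b δ n s)
    {i j : ℕ} (hij : i ≤ j) (hj : j ≤ n) : s i ≤ s j := by
  induction j, hij using Nat.le_induction with
  | base => exact le_rfl
  | succ k hk ih => exact (ih (by omega)).trans (hs.mono k (by omega))

theorem IsPartition.mem_Icc {a b δ : ℝ} {n : ℕ} {s : ℕ → ℝ} (hs : IsPartition a b δ n s)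
    {i : ℕ} (hi : i ≤ n) : s i ∈ Icc a b :=
  ⟨hs.left ▸ hs.le_of_le (Nat.zero_le i) hi, hs.right ▸ hs.le_of_le hi le_rfl⟩

/-- The uniform partition of `[a, b]` into `n` pieces. -/
theorem isPartition_uniform {a b δ : ℝ} (hab : a ≤ b) {n : ℕ} (hn : 0 < n)
    (hδ : (b - a) / n < δ) : IsPartition a b δ n (fun i => a + i * ((b - a) / n)) := by
  have hn' : (0 : ℝ) < n := by exact_mod_cast hn
  have h0 : 0 ≤ (b - a) / n := div_nonneg (by linarith) hn'.le
  refine ⟨by simp, by field_simp; ring, fun i _ => ?_, fun i _ => ?_⟩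
  · push_cast; nlinarith
  · push_cast; linarith

theorem exists_isPartition {a b δ : ℝ} (hab : a ≤ b) (hδ : 0 < δ) :
    ∃ (n : ℕ) (s : ℕ → ℝ), IsPartition a b δ n s := by
  obtain ⟨n, hn⟩ := exists_nat_gt ((b - a) / δ)
  have hn0 : (0 : ℝ) < n := (div_nonneg (by linarith) hδ.le).trans_lt hn
  refine ⟨n, _, isPartition_uniform hab (by exact_mod_cast hn0) ?_⟩
  rw [div_lt_iff₀ hn0]
  rw [div_lt_iff₀ hδ] at hn
  linarith

theorem IsPartition.concat {a b c δ : ℝ} {n m : ℕ} {s r : ℕ → ℝ} (hs : IsPartition a b δ n s)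
    (hr : IsPartition b c δ m r) :
    IsPartition a c δ (n + m) (fun i => if i ≤ n then s i else r (i - n)) ∧
      ∀ y z, symmetricSum y z (n + m) (fun i => if i ≤ n then s i else r (i - n)) =
        symmetricSum y z n s + symmetricSum y z m r := by
  have hl : ∀ i ≤ n, (if i ≤ n then s i else r (i - n)) = s i := fun i hi => if_pos hi
  -- At `i = 0` the first branch applies, and it agrees with `r 0` because both equal `b`.
  have hrt : ∀ i, (if n + i ≤ n then s (n + i) else r (n + i - n)) = r i := by
    intro i
    rcases Nat.eq_zero_or_pos i with rfl | hi
    · simp [hs.right, hr.left]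
    · rw [if_neg (by omega)]; congr 1; omega
  refine ⟨⟨by simp [hs.left], ?_, ?_, ?_⟩, ?_⟩
  · simp only [hrt]; exact hr.right
  · intro i hi
    rcases lt_or_ge i n with h | h
    · simp only [hl i h.le, hl (i + 1) h]; exact hs.mono i h
    · obtain ⟨k, rfl⟩ := Nat.exists_eq_add_of_le h
      simp only [hrt, add_assoc]; exact hr.mono k (by omega)
  · intro i hi
    rcases lt_or_ge i n with h | h
    · simp only [hl i h.le, hl (i + 1) h]; exact hs.mesh i h
    · obtain ⟨k, rfl⟩ := Nat.exists_eq_add_of_le h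
      simp only [hrt, add_assoc]; exact hr.mesh k (by omega)
  · intro y z
    unfold symmetricSum
    rw [Finset.sum_range_add]
    congr 1
    · refine Finset.sum_congr rfl fun i hi => ?_
      have := Finset.mem_range.1 hi
      simp only [hl i this.le, hl (i + 1) this]
    · refine Finset.sum_congr rfl fun i _ => ?_
      simp only [hrt, add_assoc]

/-- An indefinite symmetric integral is additive over intervals. -/
theorem HasSymmetricIntegral.sub {y z F : ℝ → ℝ} {α β : ℝ} (hα : 0 ≤ α)
    (h₁ : HasSymmetricIntegral y z 0 α (F α)) (h₂ : HasSymmetricIntegral y z 0 β (F β)) :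
    HasSymmetricIntegral y z α β (F β - F α) := by
  intro ε hε
  obtain ⟨δ₁, hδ₁, H₁⟩ := h₁ (ε / 2) (by linarith)
  obtain ⟨δ₂, hδ₂, H₂⟩ := h₂ (ε / 2) (by linarith)
  refine ⟨min δ₁ δ₂, lt_min hδ₁ hδ₂, fun n s hs => ?_⟩
  -- A fine partition of `[0, α]` is put in front, so the sum over `[α, β]` is a difference of two
  -- sums starting at `0`.
  obtain ⟨m, r, hr⟩ := exists_isPartition hα (lt_min hδ₁ hδ₂)
  obtain ⟨hc, hsum⟩ := hr.concat hs
  have e₁ := H₁ m r (hr.mono_mesh (min_le_left _ _))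
  have e₂ := H₂ _ _ (hc.mono_mesh (min_le_right _ _))
  rw [hsum y z] at e₂
  rw [abs_lt] at *
  constructor <;> linarith [e₁.1, e₁.2, e₂.1, e₂.2]

/-- The defect of the trapezoidal rule on `[a, b]`. -/
noncomputable def trapezoidDefect (y z F : ℝ → ℝ) (a b : ℝ) : ℝ :=
  F b - F a - (y a + y b) / 2 * (z b - z a)

/-- Refining the intervals with index in the complement of `J`. -/
theorem exists_refinement {y z F : ℝ → ℝ} {α β δ η : ℝ} (hη : 0 < η) (hδ : 0 < δ)
    (hF : ∀ a b, α ≤ a → a ≤ b → b ≤ β → HasSymmetricIntegral y z a b (F b - F a))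
    {n : ℕ} {s : ℕ → ℝ} (hs : IsPartition α β δ n s) (J : ℕ → Prop) [DecidablePred J]
    (k : ℕ) (hk : k ≤ n) :
    ∃ (m : ℕ) (r : ℕ → ℝ), IsPartition α (s k) δ m r ∧
      |F (s k) - F α - symmetricSum y z m r -
        ∑ i ∈ Finset.range k, if J i then trapezoidDefect y z F (s i) (s (i + 1)) else 0|
        ≤ k * η := by
  induction k with
  | zero => exact ⟨0, s, ⟨hs.left, rfl, by simp, by simp⟩, by simp [hs.left, symmetricSum]⟩
  | succ k ih =>
    obtain ⟨m, r, hr, hsum⟩ := ih (by omega)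
    rw [Finset.sum_range_succ]
    by_cases hJ : J k
    · have hp : IsPartition (s k) (s (k + 1)) δ 1 (fun i => s (k + i)) :=
        ⟨rfl, rfl, fun i hi => by
          obtain rfl : i = 0 := by omega
          exact hs.mono k (by omega), fun i hi => by
          obtain rfl : i = 0 := by omega
          exact hs.mesh k (by omega)⟩
      obtain ⟨hc, hcs⟩ := hr.concat hp
      refine ⟨_, _, hc, ?_⟩
      rw [hcs, if_pos hJ]
      have e : symmetricSum y z 1 (fun i => s (k + i)) =
          (y (s k) + y (s (k + 1))) / 2 * (z (s (k + 1)) - z (s k)) := by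
        simp [symmetricSum]
      rw [e, trapezoidDefect]
      push_cast
      refine le_trans (le_of_eq ?_) (hsum.trans (by nlinarith))
      congr 1
      ring
    -- Outside `J` the interval is subdivided until its sum is within `η` of the increment of `F`;
    -- inside `J` the single trapezoid, with its defect, is kept.
    · obtain ⟨δ', hδ', H⟩ := hF (s k) (s (k + 1)) (hs.mem_Icc (by omega)).1
        (hs.mono k (by omega)) (hs.mem_Icc hk).2 η hη
      obtain ⟨m', r', hr'⟩ := exists_isPartition (hs.mono k (by omega)) (lt_min hδ hδ')
      obtain ⟨hc, hcs⟩ := hr.concat (hr'.mono_mesh (min_le_left _ _))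
      refine ⟨_, _, hc, ?_⟩
      have e := H m' r' (hr'.mono_mesh (min_le_right _ _))
      rw [hcs, if_neg hJ, add_zero]
      push_cast
      rw [abs_le] at *
      rw [abs_lt] at e
      constructor <;> linarith [e.1, e.2, hsum.1, hsum.2]

/-- **Henstock's lemma** for the symmetric integral: the trapezoidal defects are absolutely
summable with small sum along fine partitions. -/
theorem sum_abs_trapezoidDefect_le {y z F : ℝ → ℝ} {α β : ℝ} (hαβ : α ≤ β)
    (hF : ∀ a b, α ≤ a → a ≤ b → b ≤ β → HasSymmetricIntegral y z a b (F b - F a))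
    {ε : ℝ} (hε : 0 < ε) :
    ∃ δ > 0, ∀ (n : ℕ) (s : ℕ → ℝ), IsPartition α β δ n s →
      ∑ i ∈ Finset.range n, |trapezoidDefect y z F (s i) (s (i + 1))| ≤ ε := by
  obtain ⟨δ, hδ, H⟩ := hF α β le_rfl hαβ le_rfl (ε / 4) (by linarith)
  refine ⟨δ, hδ, fun n s hs => ?_⟩
  let R := fun i => trapezoidDefect y z F (s i) (s (i + 1))
  -- Any subfamily of defects has a small sum: the refined partition is still finer than `δ` (error
  -- `ε/4`), and the subdivisions cost another `ε/4`. Taking the nonnegative and then the negative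
  -- defects bounds the absolute values.
  have key : ∀ (J : ℕ → Prop) [DecidablePred J],
      |∑ i ∈ Finset.range n, if J i then R i else 0| ≤ ε / 2 := by
    intro J _
    obtain ⟨m, r, hr, hsum⟩ := exists_refinement (η := ε / (4 * (n + 1))) (by positivity) hδ hF hs J
      n le_rfl
    rw [hs.right] at hr hsum
    have e := H m r hr
    change |_ - ∑ i ∈ Finset.range n, if J i then R i else 0| ≤ _ at hsum
    have h4 : n * (ε / (4 * (n + 1))) ≤ ε / 4 := by
      rw [mul_div_assoc', div_le_div_iff₀ (by positivity) (by norm_num)]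
      nlinarith
    rw [abs_le] at *
    rw [abs_lt] at e
    constructor <;> linarith [e.1, e.2, hsum.1, hsum.2]
  have h1 := (abs_le.1 (key fun i => 0 ≤ R i)).2
  have h2 := (abs_le.1 (key fun i => ¬ 0 ≤ R i)).1
  have : ∑ i ∈ Finset.range n, |R i| = (∑ i ∈ Finset.range n, if 0 ≤ R i then R i else 0) -
      ∑ i ∈ Finset.range n, if ¬ 0 ≤ R i then R i else 0 := by
    rw [← Finset.sum_sub_distrib]
    refine Finset.sum_congr rfl fun i _ => ?_
    by_cases h : 0 ≤ R i
    · simp [h]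
    · simp [h, abs_of_neg (not_le.1 h)]
  change ∑ i ∈ Finset.range n, |R i| ≤ ε
  linarith

/-! ### The coordinate `x̂` on the interval where `h` does not vanish -/

section Coordinate

variable {h : ℝ → ℝ} {x₀ : ℝ}

theorem self_mem_nonvanishingInterval (h0 : h x₀ ≠ 0) : x₀ ∈ nonvanishingInterval h x₀ := by
  intro y hy
  rw [uIcc_self, mem_singleton_iff] at hy
  rwa [hy]

theorem ne_zero_of_mem_nonvanishingInterval {x : ℝ} (hx : x ∈ nonvanishingInterval h x₀) :
    h x ≠ 0 := hx x right_mem_uIcc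

theorem base_ne_zero_of_mem {x : ℝ} (hx : x ∈ nonvanishingInterval h x₀) : h x₀ ≠ 0 :=
  hx x₀ left_mem_uIcc

theorem mem_nonvanishingInterval_of_mem_uIcc {x y z : ℝ} (hx : x ∈ nonvanishingInterval h x₀)
    (hy : y ∈ nonvanishingInterval h x₀) (hz : z ∈ uIcc x y) : z ∈ nonvanishingInterval h x₀ := by
  intro w hw
  have : w ∈ uIcc x₀ x ∨ w ∈ uIcc x₀ y := by
    rw [mem_uIcc] at *
    rw [mem_uIcc]
    grind
  exact this.elim (hx w) (hy w)

theorem uIcc_subset_nonvanishingInterval {x y : ℝ} (hx : x ∈ nonvanishingInterval h x₀)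
    (hy : y ∈ nonvanishingInterval h x₀) : uIcc x y ⊆ nonvanishingInterval h x₀ :=
  fun _ hz => mem_nonvanishingInterval_of_mem_uIcc hx hy hz

theorem isOpen_nonvanishingInterval (hc : Continuous h) : IsOpen (nonvanishingInterval h x₀) := by
  rw [Metric.isOpen_iff]
  intro x hx
  obtain ⟨ε, hε, H⟩ := Metric.isOpen_iff.1 (isOpen_ne_fun hc continuous_const) x
    (ne_zero_of_mem_nonvanishingInterval hx)
  refine ⟨ε, hε, fun y hy w hw => ?_⟩
  have : w ∈ uIcc x₀ x ∨ w ∈ uIcc x y := by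
    rw [mem_uIcc] at *
    rw [mem_uIcc]
    grind
  rcases this with h1 | h1
  · exact hx w h1
  · apply H
    rw [Metric.mem_ball, Real.dist_eq] at *
    exact (abs_sub_left_of_mem_uIcc h1).trans_lt hy

theorem mul_pos_of_mem_nonvanishingInterval (hc : Continuous h) {x y : ℝ}
    (hx : x ∈ nonvanishingInterval h x₀) (hy : y ∈ nonvanishingInterval h x₀) :
    0 < h x * h y := by
  by_contra hcon
  have hmem : (0 : ℝ) ∈ uIcc (h x) (h y) := by
    rw [mem_uIcc]
    rcases le_total 0 (h x) with h1 | h1 <;> rcases le_total 0 (h y) with h2 | h2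
    · right; exact ⟨by_contra fun h3 => hcon (mul_pos
        (lt_of_le_of_ne h1 (ne_zero_of_mem_nonvanishingInterval hx).symm) (not_le.1 h3)), h1⟩
    · right; exact ⟨h2, h1⟩
    · left; exact ⟨h1, h2⟩
    · left; exact ⟨h1, by_contra fun h3 => hcon (mul_pos_of_neg_of_neg
        (lt_of_le_of_ne h1 (ne_zero_of_mem_nonvanishingInterval hx)) (lt_of_le_of_ne h2
          (ne_zero_of_mem_nonvanishingInterval hy)))⟩
  obtain ⟨z, hz, hz0⟩ := intermediate_value_uIcc hc.continuousOn hmem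
  exact ne_zero_of_mem_nonvanishingInterval (mem_nonvanishingInterval_of_mem_uIcc hx hy hz) hz0

theorem hasStrictDerivAt_xHat (hc : Continuous h) {x : ℝ} (hx : x ∈ nonvanishingInterval h x₀) :
    HasStrictDerivAt (xHat h x₀) (1 / h x) x := by
  have hcont : ∀ y ∈ nonvanishingInterval h x₀, ContinuousAt (fun y => 1 / h y) y := fun y hy =>
    continuousAt_const.div hc.continuousAt (ne_zero_of_mem_nonvanishingInterval hy)
  refine intervalIntegral.integral_hasStrictDerivAt_right ?_ ?_ (hcont x hx)
  · refine ContinuousOn.intervalIntegrable fun y hy => (hcont y ?_).continuousWithinAt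
    exact uIcc_subset_nonvanishingInterval
      (self_mem_nonvanishingInterval (base_ne_zero_of_mem hx)) hx hy
  · exact (Measurable.stronglyMeasurable (by fun_prop)).stronglyMeasurableAtFilter

theorem hasDerivAt_xHat (hc : Continuous h) {x : ℝ} (hx : x ∈ nonvanishingInterval h x₀) :
    HasDerivAt (xHat h x₀) (1 / h x) x := (hasStrictDerivAt_xHat hc hx).hasDerivAt

@[simp] theorem xHat_self : xHat h x₀ x₀ = 0 := intervalIntegral.integral_same

/-- Mean value theorem for `x̂`. -/
theorem exists_xHat_sub_eq (hc : Continuous h) {x y : ℝ} (hx : x ∈ nonvanishingInterval h x₀)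
    (hy : y ∈ nonvanishingInterval h x₀) :
    ∃ ξ ∈ uIcc x y, xHat h x₀ y - xHat h x₀ x = (y - x) / h ξ := by
  wlog hxy : x ≤ y generalizing x y
  · obtain ⟨ξ, hξ, e⟩ := this hy hx (by linarith)
    refine ⟨ξ, uIcc_comm x y ▸ hξ, ?_⟩
    rw [← neg_sub, e, ← neg_div, neg_sub]
  rcases hxy.eq_or_lt with rfl | hlt
  · exact ⟨x, left_mem_uIcc, by simp⟩
  have hsub := uIcc_subset_nonvanishingInterval hx hy
  rw [uIcc_of_le hxy] at hsub ⊢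
  obtain ⟨ξ, hξ, e⟩ := exists_hasDerivAt_eq_slope (xHat h x₀) (fun x => 1 / h x) hlt
    (fun z hz => (hasDerivAt_xHat hc (hsub hz)).continuousAt.continuousWithinAt)
    (fun z hz => hasDerivAt_xHat hc (hsub (Ioo_subset_Icc_self hz)))
  refine ⟨ξ, Ioo_subset_Icc_self hξ, ?_⟩
  have : y - x ≠ 0 := by linarith
  rw [eq_div_iff this] at e
  rw [← e]; ring

theorem injOn_xHat (hc : Continuous h) : InjOn (xHat h x₀) (nonvanishingInterval h x₀) := by
  intro x hx y hy e
  obtain ⟨ξ, hξ, e'⟩ := exists_xHat_sub_eq hc hx hy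
  have h0 := ne_zero_of_mem_nonvanishingInterval (mem_nonvanishingInterval_of_mem_uIcc hx hy hξ)
  rw [e, sub_self, eq_comm, div_eq_zero_iff] at e'
  rcases e' with h1 | h1
  · linarith
  · exact absurd h1 h0

/-- Along the coordinate `x̂`, the function `h` decays at most exponentially. -/
theorem exp_neg_xHat_le (hd : Differentiable ℝ h) {a L : ℝ}
    (hL : ∀ y ∈ uIcc x₀ a, |deriv h y| ≤ L) {x : ℝ} (hx : x ∈ nonvanishingInterval h x₀)
    (hxa : x ∈ uIcc x₀ a) :
    |h x₀| * Real.exp (-(L * |xHat h x₀ x|)) ≤ |h x| := by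
  have h0 := self_mem_nonvanishingInterval (base_ne_zero_of_mem hx)
  have hne := ne_zero_of_mem_nonvanishingInterval hx
  have hc := hd.continuous
  -- Cauchy's mean value theorem for `log h` against `x̂`: the ratio of derivatives is `h'`.
  -- Negative `h` is allowed because `Real.log` ignores the sign.
  have key : ∃ ξ ∈ uIcc x₀ x, Real.log (h x) - Real.log (h x₀) = xHat h x₀ x * deriv h ξ := by
    rcases lt_trichotomy x₀ x with hlt | rfl | hlt
    · have hsub := uIcc_subset_nonvanishingInterval h0 hx
      rw [uIcc_of_le hlt.le] at hsub ⊢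
      have hl : ∀ z ∈ Icc x₀ x, HasDerivAt (fun z => Real.log (h z)) (deriv h z / h z) z :=
        fun z hz => (hd z).hasDerivAt.log (ne_zero_of_mem_nonvanishingInterval (hsub hz))
      have hxh : ∀ z ∈ Icc x₀ x, HasDerivAt (xHat h x₀) (1 / h z) z :=
        fun z hz => hasDerivAt_xHat hc (hsub hz)
      obtain ⟨ξ, hξ, e⟩ := exists_ratio_hasDerivAt_eq_ratio_slope (fun z => Real.log (h z)) _ hlt
        (fun z hz => (hl z hz).continuousAt.continuousWithinAt)
        (fun z hz => hl z (Ioo_subset_Icc_self hz)) (xHat h x₀) _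
        (fun z hz => (hxh z hz).continuousAt.continuousWithinAt)
        (fun z hz => hxh z (Ioo_subset_Icc_self hz))
      have := ne_zero_of_mem_nonvanishingInterval (hsub (Ioo_subset_Icc_self hξ))
      refine ⟨ξ, Ioo_subset_Icc_self hξ, ?_⟩
      simp only [xHat_self] at e
      field_simp at e
      linarith
    · exact ⟨x₀, by simp, by simp⟩
    · have hsub := uIcc_subset_nonvanishingInterval h0 hx
      rw [uIcc_of_ge hlt.le] at hsub ⊢
      have hl : ∀ z ∈ Icc x x₀, HasDerivAt (fun z => Real.log (h z)) (deriv h z / h z) z :=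
        fun z hz => (hd z).hasDerivAt.log (ne_zero_of_mem_nonvanishingInterval (hsub hz))
      have hxh : ∀ z ∈ Icc x x₀, HasDerivAt (xHat h x₀) (1 / h z) z :=
        fun z hz => hasDerivAt_xHat hc (hsub hz)
      obtain ⟨ξ, hξ, e⟩ := exists_ratio_hasDerivAt_eq_ratio_slope (fun z => Real.log (h z)) _ hlt
        (fun z hz => (hl z hz).continuousAt.continuousWithinAt)
        (fun z hz => hl z (Ioo_subset_Icc_self hz)) (xHat h x₀) _
        (fun z hz => (hxh z hz).continuousAt.continuousWithinAt)
        (fun z hz => hxh z (Ioo_subset_Icc_self hz))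
      have := ne_zero_of_mem_nonvanishingInterval (hsub (Ioo_subset_Icc_self hξ))
      refine ⟨ξ, Ioo_subset_Icc_self hξ, ?_⟩
      simp only [xHat_self] at e
      field_simp at e
      linarith
  obtain ⟨ξ, hξ, e⟩ := key
  have hL' : |deriv h ξ| ≤ L := hL ξ (uIcc_subset_uIcc_left hxa hξ)
  have h1 : Real.log |h x₀| - L * |xHat h x₀ x| ≤ Real.log |h x| := by
    rw [Real.log_abs, Real.log_abs]
    have h2 : |xHat h x₀ x * deriv h ξ| ≤ L * |xHat h x₀ x| := by
      rw [abs_mul, mul_comm]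
      exact mul_le_mul_of_nonneg_right hL' (abs_nonneg _)
    linarith [neg_abs_le (xHat h x₀ x * deriv h ξ)]
  have h3 := Real.exp_le_exp.2 h1
  rwa [Real.exp_sub, Real.exp_log (abs_pos.2 hne),
    Real.exp_log (abs_pos.2 (base_ne_zero_of_mem hx)), div_eq_mul_inv, ← Real.exp_neg] at h3

theorem exists_bound_deriv (hs : ContDiff ℝ ∞ h) (a b : ℝ) :
    ∃ L > 0, ∀ y ∈ uIcc a b, |deriv h y| ≤ L := by
  obtain ⟨L, hL⟩ := (isCompact_uIcc (a := a) (b := b)).exists_bound_of_continuousOn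
    (hs.continuous_deriv (by simp)).continuousOn
  exact ⟨max L 1, by positivity, fun y hy => (hL y hy).trans (le_max_left _ _)⟩

/-- If `h` has a zero to the right, then `h → 0` at the first one, and the exponential lower bound
`exp_neg_xHat_le` forces `|x̂| → ∞`. Otherwise `|h| ≤ M` gives `|x̂ x| ≥ (x - x₀) / M`. -/
theorem exists_right_le_abs_xHat (hs : ContDiff ℝ ∞ h) (hb : ∃ M : ℝ, ∀ x, |h x| ≤ M)
    (h0 : h x₀ ≠ 0) (R : ℝ) (hR : 0 < R) :
    ∃ x ∈ nonvanishingInterval h x₀, x₀ ≤ x ∧ R ≤ |xHat h x₀ x| := by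
  have hc := hs.continuous
  have h0m := self_mem_nonvanishingInterval h0
  by_cases hz : ∃ z, x₀ ≤ z ∧ h z = 0
  · set Z : Set ℝ := {z | x₀ ≤ z ∧ h z = 0} with hZ
    have hZc : IsClosed Z :=
      isClosed_Ici.inter (isClosed_eq hc continuous_const)
    have hZb : BddBelow Z := ⟨x₀, fun z hz => hz.1⟩
    obtain ⟨hz1, hz2⟩ : sInf Z ∈ Z := hZc.csInf_mem hz hZb
    set z := sInf Z
    have hlt : x₀ < z := lt_of_le_of_ne hz1 fun e => h0 (e ▸ hz2)
    obtain ⟨L, hLpos, hL⟩ := exists_bound_deriv hs x₀ z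
    have hev : ∀ᶠ x in 𝓝[<] z, |h x| < |h x₀| * Real.exp (-(L * R)) := by
      have : Tendsto (fun x => |h x|) (𝓝[<] z) (𝓝 |h z|) :=
        (hc.abs.tendsto z).mono_left nhdsWithin_le_nhds
      rw [hz2, abs_zero] at this
      exact this.eventually_lt_const (by positivity)
    obtain ⟨x, hx1, hx2⟩ := (hev.and (Ioo_mem_nhdsLT hlt)).exists
    have hxI : x ∈ nonvanishingInterval h x₀ := by
      intro y hy hy0
      rw [uIcc_of_le hx2.1.le] at hy
      have := csInf_le hZb (show y ∈ Z from ⟨hy.1, hy0⟩)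
      linarith [hy.2, hx2.2]
    refine ⟨x, hxI, hx2.1.le, ?_⟩
    have hb := exp_neg_xHat_le (hs.differentiable (by simp)) hL hxI
      (by rw [uIcc_of_le hlt.le]; exact Ioo_subset_Icc_self hx2)
    have h5 := lt_of_mul_lt_mul_left (hb.trans_lt hx1) (abs_nonneg _)
    rw [Real.exp_lt_exp] at h5
    nlinarith
  · push Not at hz
    obtain ⟨M, hM⟩ := hb
    have hMpos : 0 < M := (abs_pos.2 h0).trans_le (hM x₀)
    have hle : x₀ ≤ x₀ + M * R := by nlinarith
    have hxI : x₀ + M * R ∈ nonvanishingInterval h x₀ := fun y hy =>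
      hz y (by rw [uIcc_of_le hle] at hy; exact hy.1)
    refine ⟨_, hxI, hle, ?_⟩
    obtain ⟨ξ, hξ, e⟩ := exists_xHat_sub_eq hc h0m hxI
    rw [xHat_self, sub_zero, add_sub_cancel_left] at e
    have hξ0 := ne_zero_of_mem_nonvanishingInterval
      (mem_nonvanishingInterval_of_mem_uIcc h0m hxI hξ)
    rw [e, abs_div, abs_of_pos (mul_pos hMpos hR), le_div_iff₀ (abs_pos.2 hξ0), mul_comm]
    exact mul_le_mul_of_nonneg_right (hM ξ) hR.le

/-- Reflection `y ↦ -y` reduces this to the right-hand case; `x̂` only changes sign. -/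
theorem exists_left_le_abs_xHat (hs : ContDiff ℝ ∞ h) (hb : ∃ M : ℝ, ∀ x, |h x| ≤ M)
    (h0 : h x₀ ≠ 0) (R : ℝ) (hR : 0 < R) :
    ∃ x ∈ nonvanishingInterval h x₀, x ≤ x₀ ∧ R ≤ |xHat h x₀ x| := by
  obtain ⟨M, hM⟩ := hb
  obtain ⟨x, hx, hle, hxR⟩ := exists_right_le_abs_xHat (h := fun y => h (-y)) (x₀ := -x₀)
    (hs.comp contDiff_neg) ⟨M, fun x => hM _⟩ (by simpa using h0) R hR
  refine ⟨-x, fun y hy => ?_, by linarith, ?_⟩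
  · have : -y ∈ uIcc (-x₀) x := by
      rw [mem_uIcc] at *
      rcases hy with hy | hy
      · right; constructor <;> linarith [hy.1, hy.2]
      · left; constructor <;> linarith [hy.1, hy.2]
    simpa using hx _ this
  · have : xHat (fun y => h (-y)) (-x₀) x = -xHat h x₀ (-x) := by
      unfold xHat
      rw [intervalIntegral.integral_comp_neg (fun y => 1 / h y), neg_neg,
        intervalIntegral.integral_symm]
    rwa [this, abs_neg] at hxR

/-- `|x̂|` exceeds `|u|` on both sides of `x₀`, with opposite signs because `h` has constant sign on
the interval; the intermediate value theorem does the rest. -/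
theorem surjOn_xHat (hs : ContDiff ℝ ∞ h) (hb : ∃ M : ℝ, ∀ x, |h x| ≤ M) (h0 : h x₀ ≠ 0) :
    SurjOn (xHat h x₀) (nonvanishingInterval h x₀) univ := by
  intro u _
  have hc := hs.continuous
  have h0m := self_mem_nonvanishingInterval h0
  have hR : 0 < |u| + 1 := by positivity
  obtain ⟨a, ha, hax, haR⟩ := exists_left_le_abs_xHat hs hb h0 _ hR
  obtain ⟨b, hb, hbx, hbR⟩ := exists_right_le_abs_xHat hs hb h0 _ hR
  obtain ⟨ξ, hξ, e⟩ := exists_xHat_sub_eq hc h0m ha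
  obtain ⟨ζ, hζ, e'⟩ := exists_xHat_sub_eq hc h0m hb
  have hp := mul_pos_of_mem_nonvanishingInterval hc
    (mem_nonvanishingInterval_of_mem_uIcc h0m ha hξ)
    (mem_nonvanishingInterval_of_mem_uIcc h0m hb hζ)
  rw [xHat_self, sub_zero] at e e'
  have hopp : xHat h x₀ a * xHat h x₀ b ≤ 0 := by
    rw [e, e', div_mul_div_comm]
    exact div_nonpos_of_nonpos_of_nonneg
      (mul_nonpos_of_nonpos_of_nonneg (by linarith) (by linarith)) hp.le
  have hmem : u ∈ uIcc (xHat h x₀ a) (xHat h x₀ b) := by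
    rw [mem_uIcc]
    have h1 := le_abs_self u
    have h2 := neg_abs_le u
    rcases le_total 0 (xHat h x₀ a) with h3 | h3
    · rw [abs_of_nonneg h3] at haR
      have h4 : xHat h x₀ b ≤ 0 := by nlinarith
      rw [abs_of_nonpos h4] at hbR
      right; constructor <;> linarith
    · rw [abs_of_nonpos h3] at haR
      have h4 : 0 ≤ xHat h x₀ b := by nlinarith
      rw [abs_of_nonneg h4] at hbR
      left; constructor <;> linarith
  obtain ⟨x, hx, hxu⟩ := intermediate_value_uIcc (fun z hz => (hasDerivAt_xHat hc
    (mem_nonvanishingInterval_of_mem_uIcc ha hb hz)).continuousAt.continuousWithinAt) hmem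
  exact ⟨x, mem_nonvanishingInterval_of_mem_uIcc ha hb hx, hxu⟩

/-- The inverse of the coordinate `x̂`, i.e. the flow of `h` started at `x₀`. -/
noncomputable def flow (h : ℝ → ℝ) (x₀ : ℝ) : ℝ → ℝ :=
  Function.invFunOn (xHat h x₀) (nonvanishingInterval h x₀)

theorem flow_mem (hs : ContDiff ℝ ∞ h) (hb : ∃ M : ℝ, ∀ x, |h x| ≤ M) (h0 : h x₀ ≠ 0) (u : ℝ) :
    flow h x₀ u ∈ nonvanishingInterval h x₀ :=
  Function.invFunOn_mem (surjOn_xHat hs hb h0 (mem_univ u))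

theorem xHat_flow (hs : ContDiff ℝ ∞ h) (hb : ∃ M : ℝ, ∀ x, |h x| ≤ M) (h0 : h x₀ ≠ 0) (u : ℝ) :
    xHat h x₀ (flow h x₀ u) = u :=
  Function.invFunOn_eq (surjOn_xHat hs hb h0 (mem_univ u))

theorem flow_xHat (hc : Continuous h) {x : ℝ} (hx : x ∈ nonvanishingInterval h x₀) :
    flow h x₀ (xHat h x₀ x) = x :=
  (injOn_xHat hc).leftInvOn_invFunOn hx

/-- A nonzero strict derivative makes `x̂` carry the neighbourhood filter of a point onto that of
its image, so continuity of the inverse can be checked after composing with `x̂`. -/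
theorem continuous_flow (hs : ContDiff ℝ ∞ h) (hb : ∃ M : ℝ, ∀ x, |h x| ≤ M) (h0 : h x₀ ≠ 0) :
    Continuous (flow h x₀) := by
  rw [continuous_iff_continuousAt]
  intro u
  have hm := flow_mem hs hb h0 u
  have hmap := (hasStrictDerivAt_xHat hs.continuous hm).map_nhds_eq
    (one_div_ne_zero (ne_zero_of_mem_nonvanishingInterval hm))
  rw [xHat_flow hs hb h0] at hmap
  rw [ContinuousAt, ← hmap, tendsto_map'_iff]
  refine tendsto_id.congr' ?_
  filter_upwards [(isOpen_nonvanishingInterval hs.continuous).mem_nhds hm] with x hx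
  exact (flow_xHat hs.continuous hx).symm

theorem hasDerivAt_flow (hs : ContDiff ℝ ∞ h) (hb : ∃ M : ℝ, ∀ x, |h x| ≤ M) (h0 : h x₀ ≠ 0)
    (u : ℝ) : HasDerivAt (flow h x₀) (h (flow h x₀ u)) u := by
  have hm := flow_mem hs hb h0 u
  have := HasDerivAt.of_local_left_inverse (continuous_flow hs hb h0).continuousAt
    (hasDerivAt_xHat hs.continuous hm) (one_div_ne_zero (ne_zero_of_mem_nonvanishingInterval hm))
    (Eventually.of_forall fun y => xHat_flow hs hb h0 y)
  simpa using this

theorem flow_zero (hc : Continuous h) (h0 : h x₀ ≠ 0) : flow h x₀ 0 = x₀ := by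
  simpa using flow_xHat hc (self_mem_nonvanishingInterval h0)

end Coordinate

/-! ### Pathwise solution of the equation -/

/-- Along suitable arbitrarily fine partitions of `[α, β]`, the sum of the squared increments of
`b` becomes arbitrarily small. -/
def VanishingQuadraticVariation (b : ℝ → ℝ) (α β : ℝ) : Prop :=
  ∀ δ > 0, ∀ ε > 0, ∃ (n : ℕ) (s : ℕ → ℝ), IsPartition α β δ n s ∧
    ∑ i ∈ Finset.range n, (b (s (i + 1)) - b (s i)) ^ 2 < ε

section Pathwise

variable {h : ℝ → ℝ} {x b : ℝ → ℝ} {T : ℝ}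

/-- One-step chain rule; `D` is the increment of the driver. The increment of `x̂` is `(q - p) / h
ξ`, and the mean of `h p` and `h q` misses `h ξ` by at most `L |q - p|`, which is of order `|D|`
plus the defect. The error is thus quadratic in `D` or linear in the defect; `|D| ≤ 1` absorbs the
mixed term. -/
theorem abs_xHat_sub_sub_le (hd : Differentiable ℝ h) {y₀ c L M p q D : ℝ} {K : Set ℝ}
    (hK : K.OrdConnected) (hKI : K ⊆ nonvanishingInterval h y₀) (hc0 : 0 < c)
    (hc : ∀ y ∈ K, c ≤ |h y|) (hL0 : 0 ≤ L) (hL : ∀ y ∈ K, ‖deriv h y‖ ≤ L)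
    (hM : ∀ y, |h y| ≤ M) (hp : p ∈ K) (hq : q ∈ K) (hD : |D| ≤ 1) :
    |xHat h y₀ q - xHat h y₀ p - D| ≤
      (L * M + L + 1) / c * (D ^ 2 + |q - p - (h p + h q) / 2 * D|) := by
  obtain ⟨ξ, hξ, e⟩ := exists_xHat_sub_eq hd.continuous (hKI hp) (hKI hq)
  have hξK : ξ ∈ K := hK.uIcc_subset hp hq hξ
  have hne := ne_zero_of_mem_nonvanishingInterval (hKI hξK)
  set R := q - p - (h p + h q) / 2 * D with hR
  have hM0 : 0 ≤ M := (abs_nonneg _).trans (hM 0)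
  have lip : ∀ y ∈ K, |h y - h ξ| ≤ L * |y - ξ| := fun y hy => by
    simpa [Real.norm_eq_abs] using
      hK.convex.norm_image_sub_le_of_norm_deriv_le (fun z _ => hd z) hL hξK hy
  have hp1 : |p - ξ| ≤ |q - p| := by
    rw [abs_sub_comm]; exact abs_sub_left_of_mem_uIcc hξ
  have hq1 : |q - ξ| ≤ |q - p| := abs_sub_right_of_mem_uIcc hξ
  have hmid : |(h p + h q) / 2 - h ξ| ≤ L * |q - p| := by
    have h1 := (lip p hp).trans (mul_le_mul_of_nonneg_left hp1 hL0)
    have h2 := (lip q hq).trans (mul_le_mul_of_nonneg_left hq1 hL0)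
    rw [abs_le] at *
    constructor <;> linarith [h1.1, h1.2, h2.1, h2.2]
  have hqp : |q - p| ≤ M * |D| + |R| := by
    have : q - p = (h p + h q) / 2 * D + R := by rw [hR]; ring
    rw [this]
    refine (abs_add_le _ _).trans (add_le_add ?_ le_rfl)
    rw [abs_mul]
    refine mul_le_mul_of_nonneg_right ?_ (abs_nonneg _)
    have h1 := abs_le.1 (hM p)
    have h2 := abs_le.1 (hM q)
    rw [abs_le]
    constructor <;> linarith [h1.1, h1.2, h2.1, h2.2]
  have e2 : xHat h y₀ q - xHat h y₀ p - D = (((h p + h q) / 2 - h ξ) * D + R) / h ξ := by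
    rw [e, hR]; field_simp; ring
  rw [e2, abs_div, div_mul_eq_mul_div]
  have hD0 := abs_nonneg D
  have hR0 := abs_nonneg R
  have num : |((h p + h q) / 2 - h ξ) * D + R| ≤ (L * M + L + 1) * (D ^ 2 + |R|) := by
    refine (abs_add_le _ _).trans ?_
    rw [abs_mul]
    have h1 : |(h p + h q) / 2 - h ξ| * |D| ≤ L * (M * |D| + |R|) * |D| :=
      mul_le_mul_of_nonneg_right (hmid.trans (mul_le_mul_of_nonneg_left hqp hL0)) hD0
    have h2 : L * (M * |D| + |R|) * |D| = L * M * D ^ 2 + L * |R| * |D| := by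
      rw [← sq_abs D]; ring
    have h3 : L * |R| * |D| ≤ L * |R| := mul_le_of_le_one_right (by positivity) hD
    have h4 : 0 ≤ L * M * |R| := by positivity
    have h5 : 0 ≤ (L + 1) * D ^ 2 := by positivity
    nlinarith
  exact div_le_div₀ (by positivity) num hc0 (hc ξ hξK)

/-- The one-step errors telescope. The path has compact image, so `|h|` is bounded below on it;
Henstock's lemma controls the defects and `hqv` the squares. -/
theorem xHat_sub_xHat_eq (hs : ContDiff ℝ ∞ h) (hb : ∃ M : ℝ, ∀ x, |h x| ≤ M)
    {y₀ α β : ℝ} (hαβ : α ≤ β) (hx : ContinuousOn x (Icc α β))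
    (hint : ∀ a c, α ≤ a → a ≤ c → c ≤ β →
      HasSymmetricIntegral (fun s => h (x s)) b a c (x c - x a))
    (hI : ∀ s ∈ Icc α β, x s ∈ nonvanishingInterval h y₀)
    (hqv : VanishingQuadraticVariation b α β) :
    xHat h y₀ (x β) - xHat h y₀ (x α) = b β - b α := by
  obtain ⟨M, hM⟩ := hb
  have hd : Differentiable ℝ h := hs.differentiable (by simp)
  set K := x '' Icc α β with hKdef
  have hKc : IsCompact K := isCompact_Icc.image_of_continuousOn hx
  have hKo : K.OrdConnected := (isPreconnected_Icc.image x hx).ordConnected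
  have hKI : K ⊆ nonvanishingInterval h y₀ := by
    rintro _ ⟨s, hs, rfl⟩; exact hI s hs
  have hmem : ∀ s ∈ Icc α β, x s ∈ K := fun s hs => mem_image_of_mem x hs
  obtain ⟨k, hkK, hk⟩ := hKc.exists_isMinOn ⟨_, hmem α (left_mem_Icc.2 hαβ)⟩
    hd.continuous.abs.continuousOn
  have hc0 : 0 < |h k| := abs_pos.2 (ne_zero_of_mem_nonvanishingInterval (hKI hkK))
  obtain ⟨L, hL⟩ := hKc.exists_bound_of_continuousOn (hs.continuous_deriv (by simp)).continuousOn
  have hL0 : 0 ≤ L := (norm_nonneg _).trans (hL k hkK)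
  have hM0 : 0 ≤ M := (abs_nonneg _).trans (hM 0)
  set C := (L * M + L + 1) / |h k| with hC
  have hC0 : 0 < C := by positivity
  have key : ∀ ε > 0, |xHat h y₀ (x β) - xHat h y₀ (x α) - (b β - b α)| ≤ ε := by
    intro ε hε
    have hη : 0 < ε / (2 * C) := by positivity
    obtain ⟨δ, hδ, H⟩ := sum_abs_trapezoidDefect_le hαβ hint hη
    -- The bound `1` makes every increment of `b` at most `1` in size, as the one-step estimate
    -- requires.
    obtain ⟨n, s, hp, hsum⟩ := hqv δ hδ (min 1 (ε / (2 * C))) (lt_min one_pos hη)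
    have hdef := H n s hp
    have tel : xHat h y₀ (x β) - xHat h y₀ (x α) - (b β - b α) =
        ∑ i ∈ Finset.range n, (xHat h y₀ (x (s (i + 1))) - xHat h y₀ (x (s i)) -
          (b (s (i + 1)) - b (s i))) := by
      rw [Finset.sum_sub_distrib, Finset.sum_range_sub (fun i => xHat h y₀ (x (s i))),
        Finset.sum_range_sub (fun i => b (s i)), hp.left, hp.right]
    rw [tel]
    calc _ ≤ ∑ i ∈ Finset.range n, |xHat h y₀ (x (s (i + 1))) - xHat h y₀ (x (s i)) -
          (b (s (i + 1)) - b (s i))| := Finset.abs_sum_le_sum_abs _ _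
      _ ≤ ∑ i ∈ Finset.range n, C * ((b (s (i + 1)) - b (s i)) ^ 2 +
          |trapezoidDefect (fun s => h (x s)) b x (s i) (s (i + 1))|) := by
        refine Finset.sum_le_sum fun i hi => ?_
        have hin := Finset.mem_range.1 hi
        refine abs_xHat_sub_sub_le hd hKo hKI hc0 (fun y hy => hk hy) hL0 hL hM
          (hmem _ (hp.mem_Icc hin.le)) (hmem _ (hp.mem_Icc hin)) ?_
        have h1 : (b (s (i + 1)) - b (s i)) ^ 2 ≤ 1 :=
          (Finset.single_le_sum (f := fun i => (b (s (i + 1)) - b (s i)) ^ 2)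
            (fun j _ => sq_nonneg _) hi).trans (hsum.le.trans (min_le_left _ _))
        exact (sq_le_one_iff_abs_le_one _).1 h1
      _ = C * (∑ i ∈ Finset.range n, (b (s (i + 1)) - b (s i)) ^ 2 +
          ∑ i ∈ Finset.range n, |trapezoidDefect (fun s => h (x s)) b x (s i) (s (i + 1))|) := by
        rw [← Finset.mul_sum, Finset.sum_add_distrib]
      _ ≤ C * (ε / (2 * C) + ε / (2 * C)) := by
        gcongr
        exact hsum.le.trans (min_le_right _ _)
      _ = ε := by field_simp; ring
  have := le_of_forall_pos_le_add (a := |xHat h y₀ (x β) - xHat h y₀ (x α) - (b β - b α)|)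
    (b := 0) (fun ε hε => by simpa using key ε hε)
  exact sub_eq_zero.1 (abs_nonpos_iff.1 this)

/-- Vanishing quadratic variation will be known almost surely for countably many intervals at once,
hence rational endpoints; density and continuity of `x̂(x) - b` give the rest. -/
theorem xHat_sub_xHat_eq_of_rat (hs : ContDiff ℝ ∞ h) (hb : ∃ M : ℝ, ∀ x, |h x| ≤ M)
    {y₀ α β : ℝ} (hαβ : α ≤ β) (hx : ContinuousOn x (Icc α β)) (hbc : ContinuousOn b (Icc α β))
    (hint : ∀ a c, α ≤ a → a ≤ c → c ≤ β →
      HasSymmetricIntegral (fun s => h (x s)) b a c (x c - x a))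
    (hI : ∀ s ∈ Icc α β, x s ∈ nonvanishingInterval h y₀)
    (hqv : ∀ q r : ℚ, α ≤ q → (q : ℝ) ≤ r → (r : ℝ) ≤ β → VanishingQuadraticVariation b q r) :
    xHat h y₀ (x β) - xHat h y₀ (x α) = b β - b α := by
  rcases hαβ.eq_or_lt with rfl | hlt
  · simp
  set G : ℝ → ℝ := fun s => xHat h y₀ (x s) - b s with hG
  have hGc : ContinuousOn G (Icc α β) := by
    refine ContinuousOn.sub (fun s hs' => ?_) hbc
    exact ContinuousAt.comp_continuousWithinAt
      (hasDerivAt_xHat hs.continuous (hI s hs')).continuousAt (hx s hs')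
  obtain ⟨q₀, hq₀, hq₀'⟩ := exists_rat_btwn hlt
  have hrat : ∀ q r : ℚ, α < q → (q : ℝ) ≤ r → (r : ℝ) < β → G r = G q := by
    intro q r h1 h2 h3
    have hsub : Icc (q : ℝ) r ⊆ Icc α β := Icc_subset_Icc h1.le h3.le
    have := xHat_sub_xHat_eq hs hb h2 (hx.mono hsub)
      (fun a c ha hac hc => hint a c (h1.le.trans ha) hac (hc.trans h3.le))
      (fun s hs' => hI s (hsub hs')) (hqv q r h1.le h2 h3.le)
    simp only [hG]; linarith
  have heq : EqOn G (fun _ => G q₀) (Ioo α β ∩ range ((↑) : ℚ → ℝ)) := by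
    rintro _ ⟨hr, r, rfl⟩
    rcases le_total (q₀ : ℝ) r with hle | hle
    · exact hrat q₀ r hq₀ hle hr.2
    · exact (hrat r q₀ hr.1 hle hq₀').symm
  have hcl : Icc α β ⊆ closure (Ioo α β ∩ range ((↑) : ℚ → ℝ)) := by
    rw [← closure_Ioo hlt.ne]
    exact closure_minimal (Rat.denseRange_cast.open_subset_closure_inter isOpen_Ioo)
      isClosed_closure
  have hall := heq.of_subset_closure hGc continuousOn_const
    (inter_subset_left.trans Ioo_subset_Icc_self) hcl
  have e1 := hall (left_mem_Icc.2 hαβ)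
  have e2 := hall (right_mem_Icc.2 hαβ)
  simp only [hG] at e1 e2
  linarith

/-- The times at which the formula holds form a clopen subset of `[0, T]`. Closedness uses that the
flow exists on all of `ℝ`, so the path cannot leave the nonvanishing interval. The base time is
arbitrary so that paths can also be followed backwards. -/
theorem eq_flow_of_ne_zero (hs : ContDiff ℝ ∞ h) (hb : ∃ M : ℝ, ∀ x, |h x| ≤ M)
    (hx : ContinuousOn x (Icc 0 T)) (hbc : ContinuousOn b (Icc 0 T))
    (hint : ∀ a c, 0 ≤ a → a ≤ c → c ≤ T →
      HasSymmetricIntegral (fun s => h (x s)) b a c (x c - x a))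
    (hqv : ∀ q r : ℚ, 0 ≤ (q : ℝ) → (q : ℝ) ≤ r → (r : ℝ) ≤ T →
      VanishingQuadraticVariation b q r)
    {t₀ : ℝ} (ht₀ : t₀ ∈ Icc 0 T) (h0 : h (x t₀) ≠ 0) :
    ∀ t ∈ Icc 0 T, x t = flow h (x t₀) (b t - b t₀) := by
  set y₀ := x t₀ with hy₀
  have hc := hs.continuous
  have key : ∀ α β, 0 ≤ α → α ≤ β → β ≤ T → (∀ s ∈ Icc α β, x s ∈ nonvanishingInterval h y₀) →
      xHat h y₀ (x β) - xHat h y₀ (x α) = b β - b α := fun α β h1 h2 h3 h4 =>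
    xHat_sub_xHat_eq_of_rat hs hb h2 (hx.mono (Icc_subset_Icc h1 h3))
      (hbc.mono (Icc_subset_Icc h1 h3))
      (fun a c ha hac hc => hint a c (h1.trans ha) hac (hc.trans h3)) h4
      (fun q r hq hqr hr => hqv q r (h1.trans hq) hqr (hr.trans h3))
  have key' : ∀ s ∈ Icc 0 T, ∀ t ∈ Icc 0 T, (∀ r ∈ uIcc s t, x r ∈ nonvanishingInterval h y₀) →
      xHat h y₀ (x t) - xHat h y₀ (x s) = b t - b s := by
    intro s hs' t ht hst
    rcases le_total s t with hle | hle
    · exact key s t hs'.1 hle ht.2 (by rwa [uIcc_of_le hle] at hst)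
    · have := key t s ht.1 hle hs'.2 (by rwa [uIcc_of_ge hle] at hst)
      linarith
  let A : Set (Icc (0 : ℝ) T) := {t | x t = flow h y₀ (b t - b t₀)}
  have hxr : Continuous fun t : Icc (0 : ℝ) T => x t := continuousOn_iff_continuous_domRestrict.1 hx
  have hbr : Continuous fun t : Icc (0 : ℝ) T => b t := continuousOn_iff_continuous_domRestrict.1 hbc
  have hAc : IsClosed A :=
    isClosed_eq hxr ((continuous_flow hs hb h0).comp (hbr.sub continuous_const))
  have hAo : IsOpen A := by
    rw [Metric.isOpen_iff]
    intro s hsA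
    have hsA : x s = flow h y₀ (b s - b t₀) := hsA
    have hsI : x s ∈ nonvanishingInterval h y₀ := hsA ▸ flow_mem hs hb h0 _
    obtain ⟨r, hr, H⟩ := Metric.isOpen_iff.1 ((isOpen_nonvanishingInterval hc).preimage hxr) s hsI
    refine ⟨r, hr, fun t ht => ?_⟩
    have huI : ∀ u ∈ uIcc (s : ℝ) t, x u ∈ nonvanishingInterval h y₀ := by
      intro u hu
      have huT : u ∈ Icc (0 : ℝ) T := ordConnected_Icc.uIcc_subset s.2 t.2 hu
      refine H (show (⟨u, huT⟩ : Icc (0 : ℝ) T) ∈ Metric.ball s r from ?_)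
      rw [Metric.mem_ball, Subtype.dist_eq, Real.dist_eq] at ht ⊢
      exact (abs_sub_left_of_mem_uIcc hu).trans_lt ht
    have e := key' s s.2 t t.2 huI
    rw [hsA, xHat_flow hs hb h0] at e
    have e2 : xHat h y₀ (x t) = b t - b t₀ := by linarith
    change x t = flow h y₀ (b t - b t₀)
    rw [← e2, flow_xHat hc (huI t right_mem_uIcc)]
  have hne : A.Nonempty := ⟨⟨t₀, ht₀⟩, by
    change x t₀ = flow h y₀ (b t₀ - b t₀)
    rw [sub_self, flow_zero hc h0]⟩
  have : PreconnectedSpace (Icc (0 : ℝ) T) := isPreconnected_iff_preconnectedSpace.1 isPreconnected_Icc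
  have huniv := IsClopen.eq_univ ⟨hAc, hAo⟩ hne
  intro t ht
  have : (⟨t, ht⟩ : Icc (0 : ℝ) T) ∈ A := huniv ▸ mem_univ _
  exact this

open Classical in
/-- The solution of `Φ' = h ∘ Φ`, `Φ 0 = x₀` for bounded smooth `h`. -/
noncomputable def solutionMap (h : ℝ → ℝ) (x₀ : ℝ) : ℝ → ℝ :=
  if h x₀ = 0 then fun _ => x₀ else flow h x₀

theorem hasDerivAt_solutionMap (hs : ContDiff ℝ ∞ h) (hb : ∃ M : ℝ, ∀ x, |h x| ≤ M) (x₀ u : ℝ) :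
    HasDerivAt (solutionMap h x₀) (h (solutionMap h x₀ u)) u := by
  unfold solutionMap
  split_ifs with h0
  · rw [h0]; exact hasDerivAt_const _ _
  · exact hasDerivAt_flow hs hb h0 u

theorem solutionMap_zero (hs : ContDiff ℝ ∞ h) (x₀ : ℝ) : solutionMap h x₀ 0 = x₀ := by
  unfold solutionMap
  split_ifs with h0
  · rfl
  · exact flow_zero hs.continuous h0

theorem continuous_solutionMap (hs : ContDiff ℝ ∞ h) (hb : ∃ M : ℝ, ∀ x, |h x| ≤ M) (x₀ : ℝ) :
    Continuous (solutionMap h x₀) :=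
  continuous_iff_continuousAt.2 fun u => (hasDerivAt_solutionMap hs hb x₀ u).continuousAt

theorem eq_solutionMap (hs : ContDiff ℝ ∞ h) (hb : ∃ M : ℝ, ∀ x, |h x| ≤ M)
    (hx : ContinuousOn x (Icc 0 T)) (hbc : ContinuousOn b (Icc 0 T)) {x₀ : ℝ}
    (hx₀ : x 0 = x₀) (hb0 : b 0 = 0)
    (hint : ∀ t ∈ Icc 0 T, HasSymmetricIntegral (fun s => h (x s)) b 0 t (x t - x₀))
    (hqv : ∀ q r : ℚ, 0 ≤ (q : ℝ) → (q : ℝ) ≤ r → (r : ℝ) ≤ T →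
      VanishingQuadraticVariation b q r) :
    ∀ t ∈ Icc 0 T, x t = solutionMap h x₀ (b t) := by
  intro t ht
  have h0T : (0 : ℝ) ∈ Icc 0 T := ⟨le_rfl, ht.1.trans ht.2⟩
  have hint' : ∀ a c, 0 ≤ a → a ≤ c → c ≤ T →
      HasSymmetricIntegral (fun s => h (x s)) b a c (x c - x a) := by
    intro a c ha hac hc
    simpa using HasSymmetricIntegral.sub (F := fun t => x t - x₀) ha
      (hint a ⟨ha, hac.trans hc⟩) (hint c ⟨ha.trans hac, hc⟩)
  unfold solutionMap
  split_ifs with h0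
  -- If `h (x s) ≠ 0` for some `s`, following the flow back to time `0` would give `h x₀ ≠ 0`. So
  -- the integrand vanishes identically and the path is constant.
  · have hall : ∀ s ∈ Icc 0 T, h (x s) = 0 := by
      intro s hs'
      by_contra hne
      have e := eq_flow_of_ne_zero hs hb hx hbc hint' hqv hs' hne 0 h0T
      have hm := flow_mem hs hb hne (b 0 - b s)
      rw [← e, hx₀] at hm
      exact ne_zero_of_mem_nonvanishingInterval hm h0
    have key : ∀ ε > 0, |x t - x₀| ≤ ε := by
      intro ε hε
      obtain ⟨δ, hδ, H⟩ := hint t ht ε hε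
      obtain ⟨n, s, hp⟩ := exists_isPartition ht.1 hδ
      have e := H n s hp
      have hz : symmetricSum (fun s => h (x s)) b n s = 0 := by
        refine Finset.sum_eq_zero fun i hi => ?_
        have hin := Finset.mem_range.1 hi
        have hT : Icc 0 t ⊆ Icc 0 T := Icc_subset_Icc le_rfl ht.2
        simp [hall _ (hT (hp.mem_Icc hin.le)), hall _ (hT (hp.mem_Icc (Nat.succ_le_of_lt hin)))]
      rw [hz, zero_sub, abs_neg] at e
      exact e.le
    have := le_of_forall_pos_le_add (a := |x t - x₀|) (b := 0)
      (fun ε hε => by simpa using key ε hε)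
    exact sub_eq_zero.1 (abs_nonpos_iff.1 this)
  · have := eq_flow_of_ne_zero hs hb hx hbc hint' hqv h0T (by rwa [hx₀]) t ht
    rwa [hx₀, hb0, sub_zero] at this

end Pathwise

/-! ### Fractional Brownian motion -/

section FractionalBrownianMotion

variable {Ω : Type*} [MeasurableSpace Ω] {P : Measure Ω} {H : ℝ} {B : ℝ → Ω → ℝ}

theorem IsFractionalBrownianMotion.hasGaussianLaw (hB : IsFractionalBrownianMotion H B P) {t : ℝ}
    (ht : 0 ≤ t) : HasGaussianLaw (B t) P :=
  (hB.gaussian.hasGaussianLaw {⟨t, ht⟩}).eval ⟨⟨t, ht⟩, Finset.mem_singleton_self _⟩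

theorem IsFractionalBrownianMotion.memLp_two (hB : IsFractionalBrownianMotion H B P) {t : ℝ}
    (ht : 0 ≤ t) : MemLp (B t) 2 P := (hB.hasGaussianLaw ht).memLp_two

theorem IsFractionalBrownianMotion.integral_sq_increment (hB : IsFractionalBrownianMotion H B P)
    (hH : 0 < H) {s t : ℝ} (hs : 0 ≤ s) (ht : 0 ≤ t) :
    ∫ w, (B t w - B s w) ^ 2 ∂P = |t - s| ^ (2 * H) := by
  have hz : (0 : ℝ) ^ (2 * H) = 0 := Real.zero_rpow (by positivity)
  have e : ∀ w, (B t w - B s w) ^ 2 = B t w * B t w - 2 * (B t w * B s w) + B s w * B s w :=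
    fun w => by ring
  simp_rw [e]
  have itt : Integrable (fun w => B t w * B t w) P :=
    (hB.memLp_two ht).integrable_mul (hB.memLp_two ht)
  have its : Integrable (fun w => B t w * B s w) P :=
    (hB.memLp_two ht).integrable_mul (hB.memLp_two hs)
  have iss : Integrable (fun w => B s w * B s w) P :=
    (hB.memLp_two hs).integrable_mul (hB.memLp_two hs)
  rw [integral_add (f := fun w => B t w * B t w - 2 * (B t w * B s w)) (itt.sub (its.const_mul 2)) iss, integral_sub itt (its.const_mul 2),
    integral_const_mul, hB.covariance t t ht ht, hB.covariance s t hs ht, hB.covariance s s hs hs]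
  simp only [sub_self, abs_zero, hz]
  ring

/-- One fixed Gaussian is used for all times, so that time enters only through the scale `t ^ H`,
including `t = 0`. -/
theorem IsFractionalBrownianMotion.map_eq (hB : IsFractionalBrownianMotion H B P) (hH : 0 < H)
    {t : ℝ} (ht : 0 ≤ t) :
    P.map (B t) = (gaussianReal 0 1).map (fun z => t ^ H * z) := by
  have hg := hB.hasGaussianLaw ht
  have := hg.isProbabilityMeasure
  have hvar : Var[B t; P] = (t ^ H) ^ 2 := by
    have hz : (0 : ℝ) ^ (2 * H) = 0 := Real.zero_rpow (by positivity)
    rw [variance_eq_sub (hB.memLp_two ht)]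
    have e : ∫ w, (B t ^ 2) w ∂P = t ^ (2 * H) := by
      simp only [Pi.pow_apply, sq]
      rw [hB.covariance t t ht ht]
      simp only [sub_self, abs_zero, hz]
      ring
    rw [e, hB.mean t ht, ← Real.rpow_natCast (t ^ H), ← Real.rpow_mul ht]
    simp [mul_comm]
  rw [hg.map_eq_gaussianReal, gaussianReal_map_const_mul, hvar, hB.mean t ht, mul_zero, mul_one]
  congr 1
  ext
  simp [sq_nonneg]

/-- Along uniform partitions into `n` pieces the expected sum of squares is `(β - α)^{2H} n^{1-2H} →
0`. By Fatou its liminf is almost surely `0`, which suffices since only some fine partitions are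
needed. -/
theorem IsFractionalBrownianMotion.ae_vanishingQuadraticVariation
    (hB : IsFractionalBrownianMotion H B P) (hH : 1 / 2 < H) {α β : ℝ} (hα : 0 ≤ α)
    (hαβ : α ≤ β) : ∀ᵐ w ∂P, VanishingQuadraticVariation (fun t => B t w) α β := by
  let s : ℕ → ℕ → ℝ := fun n i => α + i * ((β - α) / (n + 1 : ℕ))
  let Q : ℕ → Ω → ℝ := fun n w =>
    ∑ i ∈ Finset.range (n + 1), (B (s n (i + 1)) w - B (s n i) w) ^ 2
  have hs0 : ∀ n i, 0 ≤ s n i := fun n i => by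
    have : 0 ≤ β - α := sub_nonneg.2 hαβ
    positivity
  have hint : ∀ n i, Integrable (fun w => (B (s n (i + 1)) w - B (s n i) w) ^ 2) P := fun n i =>
    ((hB.memLp_two (hs0 n (i + 1))).sub (hB.memLp_two (hs0 n i))).integrable_sq
  have hQint : ∀ n, Integrable (Q n) P := fun n => integrable_finsetSum _ fun i _ => hint n i
  have hQ0 : ∀ n w, 0 ≤ Q n w := fun n w => Finset.sum_nonneg fun i _ => sq_nonneg _
  have hEQ : ∀ n, ∫ w, Q n w ∂P = (β - α) ^ (2 * H) * ((n + 1 : ℕ) : ℝ) ^ (-(2 * H - 1)) := by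
    intro n
    have hn : (0 : ℝ) < ((n + 1 : ℕ) : ℝ) := by positivity
    have hd : 0 ≤ (β - α) / ((n + 1 : ℕ) : ℝ) := div_nonneg (sub_nonneg.2 hαβ) hn.le
    have e : ∀ i, s n (i + 1) - s n i = (β - α) / ((n + 1 : ℕ) : ℝ) := fun i => by
      simp only [s]; push_cast; ring
    simp only [Q]
    rw [integral_finsetSum _ fun i _ => hint n i]
    simp only [hB.integral_sq_increment (by linarith) (hs0 _ _) (hs0 _ _), e, abs_of_nonneg hd]
    rw [Finset.sum_const, Finset.card_range, nsmul_eq_mul,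
      Real.div_rpow (sub_nonneg.2 hαβ) hn.le, neg_sub, Real.rpow_sub hn, Real.rpow_one]
    field_simp
  have htend : Tendsto (fun n => ∫⁻ w, ENNReal.ofReal (Q n w) ∂P) atTop (𝓝 0) := by
    have h1 : Tendsto (fun n : ℕ => ((n + 1 : ℕ) : ℝ) ^ (-(2 * H - 1))) atTop (𝓝 0) :=
      (tendsto_rpow_neg_atTop (by linarith)).comp
        (tendsto_natCast_atTop_atTop.comp (tendsto_add_atTop_nat 1))
    have h2 := (h1.const_mul ((β - α) ^ (2 * H)))
    rw [mul_zero] at h2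
    have h3 := ENNReal.tendsto_ofReal h2
    rw [ENNReal.ofReal_zero] at h3
    refine h3.congr fun n => ?_
    rw [← hEQ n, ofReal_integral_eq_lintegral_ofReal (hQint n) (ae_of_all _ (hQ0 n))]
  have hmeas : ∀ n, AEMeasurable (fun w => ENNReal.ofReal (Q n w)) P := fun n =>
    (hQint n).aestronglyMeasurable.aemeasurable.ennreal_ofReal
  have hfatou : ∫⁻ w, liminf (fun n => ENNReal.ofReal (Q n w)) atTop ∂P = 0 := by
    refine le_antisymm ((lintegral_liminf_le' hmeas).trans ?_) zero_le
    rw [htend.liminf_eq]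
  have hliminf : AEMeasurable (fun w => liminf (fun n => ENNReal.ofReal (Q n w)) atTop) P := by
    simp_rw [liminf_eq_iSup_iInf_of_nat]
    exact AEMeasurable.iSup fun n => AEMeasurable.biInf (Ici n) (to_countable _) fun i _ => hmeas i
  rw [lintegral_eq_zero_iff' hliminf] at hfatou
  filter_upwards [hfatou] with w hw δ hδ ε hε
  have hfreq : ∃ᶠ n in atTop, ENNReal.ofReal (Q n w) < ENNReal.ofReal ε := by
    refine frequently_lt_of_liminf_lt (by isBoundedDefault) ?_
    rw [hw]
    simpa using hε
  have hmesh : ∀ᶠ n : ℕ in atTop, (β - α) / (n + 1 : ℕ) < δ := by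
    have : Tendsto (fun n : ℕ => (β - α) / ((n + 1 : ℕ) : ℝ)) atTop (𝓝 0) :=
      tendsto_const_nhds.div_atTop (tendsto_natCast_atTop_atTop.comp (tendsto_add_atTop_nat 1))
    exact this.eventually_lt_const hδ
  obtain ⟨n, hn1, hn2⟩ := (hfreq.and_eventually hmesh).exists
  exact ⟨n + 1, s n, isPartition_uniform hαβ n.succ_pos hn2,
    (ENNReal.ofReal_lt_ofReal_iff hε).1 hn1⟩

theorem IsSymmetricSDESolution.ae_eq_solutionMap (hB : IsFractionalBrownianMotion H B P)
    (hH : 1 / 2 < H) {T x₀ : ℝ} {h : ℝ → ℝ} (hs : ContDiff ℝ ∞ h) (hb : ∃ M : ℝ, ∀ x, |h x| ≤ M)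
    {X : ℝ → Ω → ℝ} (hX : IsSymmetricSDESolution P B h x₀ T X) :
    ∀ᵐ w ∂P, ∀ t ∈ Icc 0 T, X t w = solutionMap h x₀ (B t w) := by
  have hqv : ∀ᵐ w ∂P, ∀ q r : ℚ, 0 ≤ (q : ℝ) → (q : ℝ) ≤ r → (r : ℝ) ≤ T →
      VanishingQuadraticVariation (fun t => B t w) q r := by
    simp only [ae_all_iff]
    intro q r hq hqr _
    exact hB.ae_vanishingQuadraticVariation hH hq hqr
  filter_upwards [hqv, hX.continuous_paths, hX.initial, hX.equation, hB.zero,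
    hB.continuous_paths] with w h1 h2 h3 h4 h5 h6
  exact eq_solutionMap hs hb h2 (h6.mono Icc_subset_Ici_self) h3 h5 h4 h1

/-- The law of the solution, in terms of a standard Gaussian variable. -/
theorem IsSymmetricSDESolution.map_eq (hB : IsFractionalBrownianMotion H B P)
    (hH : 1 / 2 < H) {T x₀ : ℝ} {h : ℝ → ℝ} (hs : ContDiff ℝ ∞ h) (hb : ∃ M : ℝ, ∀ x, |h x| ≤ M)
    {X : ℝ → Ω → ℝ} (hX : IsSymmetricSDESolution P B h x₀ T X) {t : ℝ} (ht : t ∈ Icc 0 T) :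
    P.map (X t) = (gaussianReal 0 1).map (fun z => solutionMap h x₀ (t ^ H * z)) := by
  have hm := (continuous_solutionMap hs hb x₀).measurable
  have e : X t =ᵐ[P] solutionMap h x₀ ∘ B t := by
    filter_upwards [hX.ae_eq_solutionMap hB hH hs hb] with w hw
    exact hw t ht
  rw [Measure.map_congr e, ← AEMeasurable.map_map_of_aemeasurable hm.aemeasurable
    (hB.hasGaussianLaw ht.1).aemeasurable, hB.map_eq (by linarith) ht.1,
    Measure.map_map hm (by fun_prop)]
  rfl

end FractionalBrownianMotion

/-! ### Scaled Gaussian averages -/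

theorem hasDerivAt_gaussianPDFReal_zero_one (z : ℝ) :
    HasDerivAt (gaussianPDFReal 0 1) (-z * gaussianPDFReal 0 1 z) z := by
  rw [gaussianPDFReal_def]
  have h1 : HasDerivAt (fun x : ℝ => -(x - 0) ^ 2 / (2 * ((1 : ℝ≥0) : ℝ))) (-z) z := by
    have := (((hasDerivAt_id z).sub_const 0).pow 2).neg.div_const (2 * ((1 : ℝ≥0) : ℝ))
    refine this.congr_deriv ?_
    simp
    ring
  refine (h1.exp.const_mul _).congr_deriv ?_
  ring

theorem integrable_mul_gaussianPDFReal_zero_one :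
    Integrable fun z : ℝ => z * gaussianPDFReal 0 1 z := by
  have := (integrable_mul_exp_neg_mul_sq (b := 1 / 2) (by norm_num)).const_mul
    ((√(2 * Real.pi * ((1 : ℝ≥0) : ℝ)))⁻¹)
  refine this.congr (ae_of_all _ fun z => ?_)
  simp only [gaussianPDFReal]
  rw [mul_left_comm, show -(z - 0) ^ 2 / (2 * ((1 : ℝ≥0) : ℝ)) = -(1 / 2) * z ^ 2 by simp; ring]

/-- **Stein's identity** for bounded `C¹` functions. -/
theorem integral_mul_gaussianReal_eq {g g' : ℝ → ℝ} (hg : ∀ z, HasDerivAt g (g' z) z)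
    (hg' : Continuous g') {C C' : ℝ} (hC : ∀ z, ‖g z‖ ≤ C) (hC' : ∀ z, ‖g' z‖ ≤ C') :
    ∫ z, z * g z ∂(gaussianReal 0 1) = ∫ z, g' z ∂(gaussianReal 0 1) := by
  have hgc : Continuous g := continuous_iff_continuousAt.2 fun z => (hg z).continuousAt
  have hρ := integrable_gaussianPDFReal 0 1
  have key := integral_mul_deriv_eq_deriv_mul_of_integrable (u := g) (v := gaussianPDFReal 0 1)
    (u' := g') (v' := fun z => -z * gaussianPDFReal 0 1 z) (fun z _ => hg z)
    (fun z _ => hasDerivAt_gaussianPDFReal_zero_one z)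
    ((integrable_mul_gaussianPDFReal_zero_one.neg.bdd_mul hgc.aestronglyMeasurable
      (ae_of_all _ hC)).congr (ae_of_all _ fun z => by simp [Pi.mul_apply]))
    (hρ.bdd_mul hg'.aestronglyMeasurable (ae_of_all _ hC'))
    (hρ.bdd_mul hgc.aestronglyMeasurable (ae_of_all _ hC))
  rw [integral_gaussianReal_eq_integral_smul one_ne_zero,
    integral_gaussianReal_eq_integral_smul one_ne_zero]
  simp only [smul_eq_mul]
  have e1 : ∫ z, gaussianPDFReal 0 1 z * (z * g z) =
      -∫ z, g z * (-z * gaussianPDFReal 0 1 z) := by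
    rw [← integral_neg]
    congr 1; ext z; ring
  rw [e1, key, neg_neg]
  congr 1; ext z; ring

theorem integrable_id_gaussianReal_zero_one : Integrable (fun z : ℝ => z) (gaussianReal 0 1) :=
  (IsGaussian.hasGaussianLaw_id (μ := gaussianReal 0 1)).integrable

/-- Differentiation under the integral brings down a factor `z`, which Stein's identity trades for a
second derivative and a factor `c`. -/
theorem hasDerivAt_integral_gaussianReal {f f₁ f₂ : ℝ → ℝ} (hf : ∀ u, HasDerivAt f (f₁ u) u)
    (hf₁ : ∀ u, HasDerivAt f₁ (f₂ u) u) (hf₂ : Continuous f₂) {C C₁ C₂ : ℝ}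
    (hC : ∀ u, ‖f u‖ ≤ C) (hC₁ : ∀ u, ‖f₁ u‖ ≤ C₁) (hC₂ : ∀ u, ‖f₂ u‖ ≤ C₂) (c : ℝ) :
    HasDerivAt (fun c => ∫ z, f (c * z) ∂(gaussianReal 0 1))
      (c * ∫ z, f₂ (c * z) ∂(gaussianReal 0 1)) c := by
  have hfc : Continuous f := continuous_iff_continuousAt.2 fun z => (hf z).continuousAt
  have hf₁c : Continuous f₁ := continuous_iff_continuousAt.2 fun z => (hf₁ z).continuousAt
  have key := hasDerivAt_integral_of_dominated_loc_of_deriv_le (μ := gaussianReal 0 1)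
    (F := fun c z => f (c * z)) (F' := fun c z => z * f₁ (c * z)) (x₀ := c) (s := univ)
    (bound := fun z => ‖z‖ * C₁) univ_mem
    (Eventually.of_forall fun c => Continuous.aestronglyMeasurable (by fun_prop))
    (Integrable.of_bound (Continuous.aestronglyMeasurable (by fun_prop)) C
      (ae_of_all _ fun z => hC _))
    (Continuous.aestronglyMeasurable (by fun_prop))
    (ae_of_all _ fun z c _ => by
      rw [norm_mul]; exact mul_le_mul_of_nonneg_left (hC₁ _) (norm_nonneg _))
    (integrable_id_gaussianReal_zero_one.norm.mul_const C₁)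
    (ae_of_all _ fun z c _ => by
      have := (hf (c * z)).comp c ((hasDerivAt_id c).mul_const z)
      exact this.congr_deriv (by ring))
  refine key.2.congr_deriv ?_
  rw [← integral_const_mul]
  refine integral_mul_gaussianReal_eq (C := C₁) (C' := |c| * C₂) (fun z => ?_) (by fun_prop)
    (fun z => hC₁ _) (fun z => ?_)
  · have := (hf₁ (c * z)).comp z ((hasDerivAt_id z).const_mul c)
    exact this.congr_deriv (by ring)
  · rw [norm_mul]; exact mul_le_mul_of_nonneg_left (hC₂ _) (norm_nonneg _)

theorem tendsto_integral_gaussianReal_rpow {f : ℝ → ℝ} (hf : Continuous f) {C : ℝ}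
    (hC : ∀ u, ‖f u‖ ≤ C) {H : ℝ} (hH : 0 < H) :
    Tendsto (fun t : ℝ => ∫ z, f (t ^ H * z) ∂(gaussianReal 0 1)) (𝓝[>] 0) (𝓝 (f 0)) := by
  have e : f 0 = ∫ _ : ℝ, f 0 ∂(gaussianReal 0 1) := by simp
  rw [e]
  refine tendsto_integral_filter_of_dominated_convergence (fun _ => C)
    (Eventually.of_forall fun t => Continuous.aestronglyMeasurable (by fun_prop))
    (Eventually.of_forall fun t => ae_of_all _ fun z => hC _) (integrable_const _)
    (ae_of_all _ fun z => ?_)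
  have h1 : Tendsto (fun t : ℝ => t ^ H) (𝓝[>] 0) (𝓝 0) := by
    have := (Real.continuousAt_rpow_const 0 H (Or.inr hH.le)).tendsto
    rw [Real.zero_rpow hH.ne'] at this
    exact this.mono_left nhdsWithin_le_nhds
  have h2 := h1.mul_const z
  rw [zero_mul] at h2
  exact (hf.tendsto 0).comp h2

theorem tendsto_integral_map_gaussianReal {Φ : ℝ → ℝ} (hΦ : Continuous Φ) {H : ℝ} (hH : 0 < H)
    (g : ℝ →ᵇ ℝ) :
    Tendsto (fun t : ℝ => ∫ x, g x ∂((gaussianReal 0 1).map fun z => Φ (t ^ H * z))) (𝓝[>] 0)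
      (𝓝 (g (Φ 0))) := by
  refine (tendsto_integral_gaussianReal_rpow (f := fun u => g (Φ u)) (by fun_prop)
    (fun u => g.norm_coe_le_norm _) hH).congr fun t => ?_
  rw [integral_map (Continuous.aemeasurable (by fun_prop)) g.continuous.aestronglyMeasurable]

theorem weakPDE_gaussian {h Φ φ : ℝ → ℝ} (hs : ContDiff ℝ ∞ h)
    (hΦ : ∀ u, HasDerivAt Φ (h (Φ u)) u) (hφ : ContDiff ℝ ∞ φ) (hφc : HasCompactSupport φ)
    {H t : ℝ} (ht : 0 < t) :
    HasDerivAt (fun s : ℝ => ∫ x, φ x ∂((gaussianReal 0 1).map fun z => Φ (s ^ H * z)))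
      (∫ x, (H * t ^ (2 * H - 1) * (deriv h x * h x) * deriv φ x
        + H * t ^ (2 * H - 1) * h x ^ 2 * iteratedDeriv 2 φ x)
          ∂((gaussianReal 0 1).map fun z => Φ (t ^ H * z))) t := by
  have hΦc : Continuous Φ := continuous_iff_continuousAt.2 fun z => (hΦ z).continuousAt
  have hhc := hs.continuous
  have hh' : Continuous (deriv h) := hs.continuous_deriv (by simp)
  have hφ1 : Continuous (deriv φ) := hφ.continuous_deriv (by simp)
  have hφ2 : Continuous (deriv (deriv φ)) := by
    have := hφ.continuous_iteratedDeriv 2 (by norm_cast)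
    rwa [iteratedDeriv_succ, iteratedDeriv_one] at this
  have hφd : ∀ x, HasDerivAt φ (deriv φ x) x := fun x =>
    (hφ.differentiable (by simp) x).hasDerivAt
  have hφd2 : ∀ x, HasDerivAt (deriv φ) (deriv (deriv φ) x) x := fun x => by
    have := hφ.differentiable_iteratedDeriv 1 (by norm_cast)
    rw [iteratedDeriv_one] at this
    exact (this x).hasDerivAt
  have hhd : ∀ x, HasDerivAt h (deriv h x) x := fun x => (hs.differentiable (by simp) x).hasDerivAt
  let F₂ : ℝ → ℝ := fun x => deriv h x * h x * deriv φ x + h x ^ 2 * deriv (deriv φ) x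
  have hF₂ : Continuous F₂ := by fun_prop
  have bdd : ∀ ψ : ℝ → ℝ, Continuous ψ → HasCompactSupport ψ → ∃ C, ∀ x, ‖ψ x‖ ≤ C :=
    fun ψ h1 h2 => h2.exists_bound_of_continuous h1
  obtain ⟨C, hC⟩ := bdd φ hφ.continuous hφc
  -- The compact support of `φ` supplies the bounds; `h'` itself may be unbounded.
  obtain ⟨C₁, hC₁⟩ := bdd (fun x => h x * deriv φ x) (by fun_prop) hφc.deriv.mul_left
  obtain ⟨C₂, hC₂⟩ := bdd F₂ hF₂ (hφc.deriv.mul_left.add hφc.deriv.deriv.mul_left)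
  have key := hasDerivAt_integral_gaussianReal (f := fun u => φ (Φ u))
    (f₁ := fun u => h (Φ u) * deriv φ (Φ u)) (f₂ := fun u => F₂ (Φ u))
    (fun u => ((hφd _).comp u (hΦ u)).congr_deriv (mul_comm _ _))
    (fun u => by
      refine (((hhd _).comp u (hΦ u)).mul ((hφd2 _).comp u (hΦ u))).congr_deriv ?_
      simp only [F₂, Function.comp_apply]; ring)
    (hF₂.comp hΦc) (fun u => hC _) (fun u => hC₁ _) (fun u => hC₂ _) (t ^ H)
  have hpow : HasDerivAt (fun s : ℝ => s ^ H) (H * t ^ (H - 1)) t :=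
    Real.hasDerivAt_rpow_const (Or.inl ht.ne')
  have hcomp := key.comp t hpow
  have e1 : (fun s : ℝ => ∫ x, φ x ∂((gaussianReal 0 1).map fun z => Φ (s ^ H * z))) =
      (fun c => ∫ z, φ (Φ (c * z)) ∂(gaussianReal 0 1)) ∘ fun s : ℝ => s ^ H := by
    ext s
    rw [integral_map (Continuous.aemeasurable (by fun_prop))
      hφ.continuous.aestronglyMeasurable]
    rfl
  rw [e1]
  refine hcomp.congr_deriv ?_
  have e2 : ∀ x, H * t ^ (2 * H - 1) * (deriv h x * h x) * deriv φ x
        + H * t ^ (2 * H - 1) * h x ^ 2 * iteratedDeriv 2 φ x = H * t ^ (2 * H - 1) * F₂ x := by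
    intro x
    rw [iteratedDeriv_succ, iteratedDeriv_one]
    simp only [F₂]; ring
  simp_rw [e2]
  rw [integral_const_mul, integral_map (Continuous.aemeasurable (by fun_prop))
    hF₂.aestronglyMeasurable]
  have e3 : t ^ (2 * H - 1) = t ^ H * t ^ (H - 1) := by
    rw [← Real.rpow_add ht]; congr 1; ring
  rw [e3]; ring

/-! ### Regularity of the explicit density -/

section Density

variable {h : ℝ → ℝ} {x₀ : ℝ}

/-- `w x̂^m h^{-k} exp (-x̂² / (2v))` on the nonvanishing interval, extended by `0`. -/
noncomputable def densityTerm (h : ℝ → ℝ) (x₀ v : ℝ) (w : ℝ → ℝ) (m k : ℕ) : ℝ → ℝ :=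
  (nonvanishingInterval h x₀).indicator fun x =>
    w x * xHat h x₀ x ^ m * (h x)⁻¹ ^ k * Real.exp (-(xHat h x₀ x ^ 2) / (2 * v))

theorem densityTerm_of_mem {v : ℝ} {w : ℝ → ℝ} {m k : ℕ} {x : ℝ}
    (hx : x ∈ nonvanishingInterval h x₀) : densityTerm h x₀ v w m k x =
      w x * xHat h x₀ x ^ m * (h x)⁻¹ ^ k * Real.exp (-(xHat h x₀ x ^ 2) / (2 * v)) :=
  indicator_of_mem hx _

theorem densityTerm_of_notMem {v : ℝ} {w : ℝ → ℝ} {m k : ℕ} {x : ℝ}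
    (hx : x ∉ nonvanishingInterval h x₀) : densityTerm h x₀ v w m k x = 0 :=
  indicator_of_notMem hx _

/-- Near an outside point `a`, only the part of the interval between `x₀` and `a` is visible, so
bounds on a compact segment suffice. -/
theorem eventually_mem_uIcc {a : ℝ} (h0 : h x₀ ≠ 0) (ha : a ∉ nonvanishingInterval h x₀) :
    ∀ᶠ x in 𝓝 a, x ∈ nonvanishingInterval h x₀ → x ∈ uIcc x₀ a := by
  have hne : a ≠ x₀ := fun e => ha (by rw [e]; exact self_mem_nonvanishingInterval h0)
  have hm := self_mem_nonvanishingInterval h0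
  rcases lt_or_gt_of_ne hne with hlt | hlt
  · filter_upwards [Iio_mem_nhds hlt] with x hx hxI
    rw [uIcc_of_ge hlt.le]
    refine ⟨by_contra fun hc => ha ?_, hx.le⟩
    exact mem_nonvanishingInterval_of_mem_uIcc hxI hm
      (by rw [uIcc_of_le hx.le]; exact ⟨(not_le.1 hc).le, hlt.le⟩)
  · filter_upwards [Ioi_mem_nhds hlt] with x hx hxI
    rw [uIcc_of_le hlt.le]
    refine ⟨hx.le, by_contra fun hc => ha ?_⟩
    exact mem_nonvanishingInterval_of_mem_uIcc hm hxI
      (by rw [uIcc_of_le hx.le]; exact ⟨hlt.le, (not_le.1 hc).le⟩)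

/-- Some zero of `h` lies between `x` and `a` (possibly `a` itself); the mean value inequality from
that zero gives the bound. -/
theorem abs_le_mul_abs_sub_of_notMem (hd : Differentiable ℝ h) {a L : ℝ}
    (hL : ∀ y ∈ uIcc x₀ a, |deriv h y| ≤ L) (ha : a ∉ nonvanishingInterval h x₀) {x : ℝ}
    (hx : x ∈ nonvanishingInterval h x₀) (hxa : x ∈ uIcc x₀ a) : |h x| ≤ L * |x - a| := by
  simp only [nonvanishingInterval, mem_ofPred_eq, not_forall, not_not] at ha
  obtain ⟨z, hz, hz0⟩ := ha
  have hzx : z ∉ uIcc x₀ x := fun hc => hx z hc hz0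
  have hle : |x - z| ≤ |x - a| := by
    rw [mem_uIcc] at *
    grind
  have hL0 : 0 ≤ L := (abs_nonneg _).trans (hL z hz)
  have := (convex_uIcc x₀ a).norm_image_sub_le_of_norm_deriv_le (fun y _ => hd y) hL hz hxa
  rw [hz0, sub_zero, Real.norm_eq_abs, Real.norm_eq_abs] at this
  exact this.trans (mul_le_mul_of_nonneg_left hle hL0)

/-- With `y = |x̂|`, `y^m ≤ e^{my}` and `|h|^{-k}` grows at most like `e^{kLy}`. Completing the
square bounds `(m + kL) y - y²/(2v)` by `v (m + kL)²/2`. -/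
theorem abs_xHat_pow_mul_exp_le (hd : Differentiable ℝ h) {a L v : ℝ} (hv : 0 < v)
    (hL : ∀ y ∈ uIcc x₀ a, |deriv h y| ≤ L) (m k : ℕ) {x : ℝ}
    (hx : x ∈ nonvanishingInterval h x₀) (hxa : x ∈ uIcc x₀ a) :
    |xHat h x₀ x| ^ m * Real.exp (-(xHat h x₀ x ^ 2) / (2 * v)) ≤
      Real.exp (v * (m + k * L) ^ 2 / 2) / |h x₀| ^ k * |h x| ^ k := by
  have hlow := exp_neg_xHat_le hd hL hx hxa
  have h0 : 0 < |h x₀| := abs_pos.2 (base_ne_zero_of_mem hx)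
  set y := |xHat h x₀ x| with hy
  have hy2 : xHat h x₀ x ^ 2 = y ^ 2 := (sq_abs _).symm
  have hy0 : 0 ≤ y := abs_nonneg _
  have h1 : y ^ m ≤ Real.exp (m * y) := by
    rw [Real.exp_nat_mul]
    exact pow_le_pow_left₀ hy0 ((le_add_of_nonneg_right zero_le_one).trans (Real.add_one_le_exp y)) m
  have h2 : |h x₀| ^ k * Real.exp (-(k * (L * y))) ≤ |h x| ^ k := by
    have := pow_le_pow_left₀ (by positivity) hlow k
    rwa [mul_pow, ← Real.exp_nat_mul, mul_neg] at this
  have h3 : Real.exp (m * y) * Real.exp (-(y ^ 2) / (2 * v)) ≤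
      Real.exp (v * (m + k * L) ^ 2 / 2) * Real.exp (-(k * (L * y))) := by
    rw [← Real.exp_add, ← Real.exp_add, Real.exp_le_exp]
    have : v * (m + k * L) ^ 2 / 2 + -(k * (L * y)) - (m * y + -(y ^ 2) / (2 * v)) =
        (v * (m + k * L) - y) ^ 2 / (2 * v) := by field_simp; ring
    have h4 : 0 ≤ (v * (m + k * L) - y) ^ 2 / (2 * v) := by positivity
    linarith
  rw [hy2]
  calc y ^ m * Real.exp (-(y ^ 2) / (2 * v)) ≤ Real.exp (m * y) * Real.exp (-(y ^ 2) / (2 * v)) := by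
        gcongr
    _ ≤ _ := h3
    _ = Real.exp (v * (m + k * L) ^ 2 / 2) / |h x₀| ^ k *
        (|h x₀| ^ k * Real.exp (-(k * (L * y)))) := by field_simp
    _ ≤ _ := by gcongr

/-- At points outside the nonvanishing interval, all terms vanish to second order. -/
theorem densityTerm_isBigO (hs : ContDiff ℝ ∞ h) (h0 : h x₀ ≠ 0) {v : ℝ} (hv : 0 < v)
    {w : ℝ → ℝ} (hw : Continuous w) (m k : ℕ) {a : ℝ} (ha : a ∉ nonvanishingInterval h x₀) :
    densityTerm h x₀ v w m k =O[𝓝 a] fun x => ‖x - a‖ ^ 2 := by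
  have hd : Differentiable ℝ h := hs.differentiable (by simp)
  obtain ⟨L, hL0, hL⟩ := exists_bound_deriv hs x₀ a
  -- Of the `k + 2` powers of `h`, `k` cancel `h⁻¹ ^ k`; the other two give the order `|x - a|²`.
  set C := Real.exp (v * (m + (k + 2 : ℕ) * L) ^ 2 / 2) / |h x₀| ^ (k + 2)
  have hC : 0 ≤ C := by positivity
  refine Asymptotics.IsBigO.of_bound ((|w a| + 1) * C * L ^ 2) ?_
  have hwa : ∀ᶠ x in 𝓝 a, |w x| < |w a| + 1 :=
    (hw.abs.tendsto a).eventually_lt_const (by linarith)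
  filter_upwards [eventually_mem_uIcc h0 ha, hwa] with x hx hwx
  by_cases hxI : x ∈ nonvanishingInterval h x₀
  · have hxa := hx hxI
    have hne := ne_zero_of_mem_nonvanishingInterval hxI
    have b1 := abs_xHat_pow_mul_exp_le hd hv hL m (k + 2) hxI hxa
    have b2 := abs_le_mul_abs_sub_of_notMem hd hL ha hxI hxa
    have hpos : 0 < |h x| := abs_pos.2 hne
    rw [densityTerm_of_mem hxI]
    simp only [norm_mul, norm_pow, norm_inv, Real.norm_eq_abs, Real.abs_exp, abs_abs]
    calc |w x| * |xHat h x₀ x| ^ m * |h x|⁻¹ ^ k * Real.exp (-(xHat h x₀ x ^ 2) / (2 * v))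
        = |w x| * (|xHat h x₀ x| ^ m * Real.exp (-(xHat h x₀ x ^ 2) / (2 * v))) * |h x|⁻¹ ^ k := by
          ring
      _ ≤ (|w a| + 1) * (C * |h x| ^ (k + 2)) * |h x|⁻¹ ^ k := by gcongr
      _ = (|w a| + 1) * C * |h x| ^ 2 := by rw [pow_add, inv_pow]; field_simp
      _ ≤ (|w a| + 1) * C * (L * |x - a|) ^ 2 := by gcongr
      _ = _ := by ring
  · rw [densityTerm_of_notMem hxI, norm_zero]
    positivity

/-- The family is closed under differentiation; off the interval the quadratic bound gives
derivative `0`. When `m = 0` the truncated `m - 1` is harmless, its coefficient being `0`. -/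
theorem hasDerivAt_densityTerm (hs : ContDiff ℝ ∞ h) (h0 : h x₀ ≠ 0) {v : ℝ} (hv : 0 < v)
    {w w' : ℝ → ℝ} (hw : ∀ x, HasDerivAt w (w' x) x) (m k : ℕ) (x : ℝ) :
    HasDerivAt (densityTerm h x₀ v w m k)
      (densityTerm h x₀ v w' m k x + densityTerm h x₀ v (fun y => w y * m) (m - 1) (k + 1) x
        - densityTerm h x₀ v (fun y => w y * (k * deriv h y)) m (k + 1) x
        - densityTerm h x₀ v (fun y => w y / v) (m + 1) (k + 1) x) x := by
  have hd : Differentiable ℝ h := hs.differentiable (by simp)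
  by_cases hx : x ∈ nonvanishingInterval h x₀
  · have hne := ne_zero_of_mem_nonvanishingInterval hx
    have hy := hasDerivAt_xHat hd.continuous hx
    have hE : HasDerivAt (fun x => Real.exp (-(xHat h x₀ x ^ 2) / (2 * v)))
        (Real.exp (-(xHat h x₀ x ^ 2) / (2 * v)) * (-(xHat h x₀ x) / v * (1 / h x))) x := by
      refine ((hy.pow 2).neg.div_const (2 * v)).exp.congr_deriv ?_
      simp only [Pi.neg_apply, Pi.pow_apply]
      field_simp
      norm_num
      ring
    have hk : HasDerivAt (fun x => (h x)⁻¹ ^ k) (-(k * deriv h x) * (h x)⁻¹ ^ (k + 1)) x := by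
      refine (((hd x).hasDerivAt.inv hne).pow k).congr_deriv ?_
      rcases k with _ | k
      · simp
      · simp only [Pi.inv_apply, Nat.add_sub_cancel, inv_pow]
        push_cast
        field_simp
        ring
    have hall := (((hw x).mul (hy.pow m)).mul hk).mul hE
    have hev : densityTerm h x₀ v w m k =ᶠ[𝓝 x] fun x =>
        w x * xHat h x₀ x ^ m * (h x)⁻¹ ^ k * Real.exp (-(xHat h x₀ x ^ 2) / (2 * v)) := by
      filter_upwards [(isOpen_nonvanishingInterval hd.continuous).mem_nhds hx] with z hz
      exact densityTerm_of_mem hz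
    refine (hall.congr_of_eventuallyEq hev).congr_deriv ?_
    simp only [densityTerm_of_mem hx, Pi.mul_apply, Pi.pow_apply]
    ring
  · simp only [densityTerm_of_notMem hx, add_zero, sub_zero]
    have hwc : Continuous w := continuous_iff_continuousAt.2 fun x => (hw x).continuousAt
    have : HasFDerivAt (densityTerm h x₀ v w m k) (0 : ℝ →L[ℝ] ℝ) x :=
      (densityTerm_isBigO hs h0 hv hwc m k hx).hasFDerivAt one_lt_two
    simpa using this.hasDerivAt

/-- The normalising constant of the density, with the sign of `h x₀`. -/
noncomputable def densityConst (h : ℝ → ℝ) (x₀ v : ℝ) : ℝ :=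
  |h x₀| / h x₀ * (√(2 * Real.pi * v))⁻¹

/-- This exhibits the Gaussian density of variance `t^{2H}` at `x̂ x` times the Jacobian `|x̂'| =
1/|h|`, which is what fixes `C₁`. -/
theorem explicitDensity_of_mem {H x t : ℝ} (ht : 0 < t) (hx : x ∈ nonvanishingInterval h x₀) :
    explicitDensity (1 / (2 * √Real.pi)) H h x₀ x t = |h x|⁻¹ *
      ((√(2 * Real.pi * t ^ (2 * H)))⁻¹ *
        Real.exp (-(xHat h x₀ x ^ 2) / (2 * t ^ (2 * H)))) := by
  have hv : 0 < t ^ (2 * H) := Real.rpow_pos_of_pos ht _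
  have hne : 0 < |h x| := abs_pos.2 (ne_zero_of_mem_nonvanishingInterval hx)
  rw [explicitDensity, indicator_of_mem hx, ← mul_assoc]
  congr 1
  rw [Real.sqrt_mul' _ (sq_nonneg _), Real.sqrt_sq_eq_abs]
  have e : √(2 * Real.pi * t ^ (2 * H)) = 2 * √Real.pi * √(1 / 2 * t ^ (2 * H)) := by
    rw [Real.sqrt_eq_iff_mul_self_eq (by positivity) (by positivity)]
    symm
    have h1 := Real.mul_self_sqrt Real.pi_pos.le
    have h2 := Real.mul_self_sqrt (show 0 ≤ 1 / 2 * t ^ (2 * H) by positivity)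
    calc _ = 4 * (√Real.pi * √Real.pi) * (√(1 / 2 * t ^ (2 * H)) * √(1 / 2 * t ^ (2 * H))) := by
          ring
      _ = _ := by rw [h1, h2]; ring
  rw [e]
  have : 0 < √(1 / 2 * t ^ (2 * H)) := by positivity
  have : 0 < √Real.pi := Real.sqrt_pos.2 Real.pi_pos
  field_simp

theorem explicitDensity_of_notMem {C H x t : ℝ} (hx : x ∉ nonvanishingInterval h x₀) :
    explicitDensity C H h x₀ x t = 0 := indicator_of_notMem hx _

/-- Constant sign of `h` lets `1/|h|` be replaced by a constant times `1/h`. -/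
theorem explicitDensity_eq_densityTerm (hc : Continuous h) {H t : ℝ} (ht : 0 < t) :
    (fun x => explicitDensity (1 / (2 * √Real.pi)) H h x₀ x t) =
      densityTerm h x₀ (t ^ (2 * H)) (fun _ => densityConst h x₀ (t ^ (2 * H))) 0 1 := by
  ext x
  by_cases hx : x ∈ nonvanishingInterval h x₀
  · rw [explicitDensity_of_mem ht hx, densityTerm_of_mem hx, densityConst]
    have hsign := mul_pos_of_mem_nonvanishingInterval hc
      (self_mem_nonvanishingInterval (base_ne_zero_of_mem hx)) hx
    have e : |h x|⁻¹ = |h x₀| / h x₀ * (h x)⁻¹ := by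
      have h1 := base_ne_zero_of_mem hx
      have h2 := ne_zero_of_mem_nonvanishingInterval hx
      rcases lt_or_gt_of_ne h1 with h3 | h3
      · have h4 : h x < 0 := by nlinarith
        rw [abs_of_neg h3, abs_of_neg h4]; field_simp
      · have h4 : 0 < h x := by nlinarith
        rw [abs_of_pos h3, abs_of_pos h4]; field_simp
    rw [e, pow_zero, pow_one]
    ring
  · rw [explicitDensity_of_notMem hx, densityTerm_of_notMem hx]

theorem hasDerivAt_timeProfile (A y : ℝ) {v : ℝ} (hv : 0 < v) :
    HasDerivAt (fun v => A * ((√(2 * Real.pi * v))⁻¹ * Real.exp (-(y ^ 2) / (2 * v))))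
      (A * ((√(2 * Real.pi * v))⁻¹ * Real.exp (-(y ^ 2) / (2 * v)))
        * ((y ^ 2 / v ^ 2 - 1 / v) / 2)) v := by
  have hpos : 0 < 2 * Real.pi * v := by positivity
  have hsq : 0 < √(2 * Real.pi * v) := Real.sqrt_pos.2 hpos
  have h1 : HasDerivAt (fun v => (√(2 * Real.pi * v))⁻¹)
      ((√(2 * Real.pi * v))⁻¹ * (-(1 / (2 * v)))) v := by
    refine ((((hasDerivAt_id v).const_mul (2 * Real.pi)).sqrt hpos.ne').inv hsq.ne').congr_deriv ?_
    simp only [id, mul_one]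
    have e : √(2 * Real.pi * v) ^ 2 = 2 * Real.pi * v := Real.sq_sqrt hpos.le
    rw [e]
    field_simp
  have h2 : HasDerivAt (fun v => Real.exp (-(y ^ 2) / (2 * v)))
      (Real.exp (-(y ^ 2) / (2 * v)) * (y ^ 2 / (2 * v ^ 2))) v := by
    have := (hasDerivAt_const v (-(y ^ 2))).div ((hasDerivAt_id v).const_mul 2)
      (by simpa using hv.ne')
    refine this.exp.congr_deriv ?_
    simp only [id, mul_one, Pi.div_apply]
    field_simp
    ring
  refine ((h1.mul h2).const_mul A).congr_deriv ?_
  field_simp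
  ring

/-- The right-hand side is `H t^{2H-1} ∂_x (h ∂_x (h p))`. As `h ∂_x` is differentiation in `x̂`,
this is the heat equation for `h p` with variance `t^{2H}` as clock. -/
theorem isClassicalPDEESolution_explicitDensity (hs : ContDiff ℝ ∞ h) (h0 : h x₀ ≠ 0) (H : ℝ) :
    IsClassicalPDEESolution H h (explicitDensity (1 / (2 * √Real.pi)) H h x₀) := by
  intro t ht
  set v := t ^ (2 * H) with hvdef
  have hv : 0 < v := Real.rpow_pos_of_pos ht _
  have hd1 : ∀ x, HasDerivAt h (deriv h x) x := fun x => (hs.differentiable (by simp) x).hasDerivAt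
  have hs' : ContDiff ℝ ∞ (deriv h) := (contDiff_infty_iff_deriv.1 hs).2
  have hs'' : ContDiff ℝ ∞ (deriv (deriv h)) := (contDiff_infty_iff_deriv.1 hs').2
  have hd2 : ∀ x, HasDerivAt (deriv h) (deriv (deriv h) x) x := fun x =>
    (hs'.differentiable (by simp) x).hasDerivAt
  have hd3 : ∀ x, HasDerivAt (deriv (deriv h)) (deriv (deriv (deriv h)) x) x := fun x =>
    (hs''.differentiable (by simp) x).hasDerivAt
  set κ := densityConst h x₀ v with hκ
  set p : ℝ → ℝ := fun x => explicitDensity (1 / (2 * √Real.pi)) H h x₀ x t with hp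
  have hpe : p = densityTerm h x₀ v (fun _ => κ) 0 1 := explicitDensity_eq_densityTerm hs.continuous ht
  let p₁ : ℝ → ℝ := fun x => densityTerm h x₀ v (fun y => -κ * deriv h y) 0 2 x +
    densityTerm h x₀ v (fun _ => -κ / v) 1 2 x
  -- All terms are brought to the common power `h⁻³`, e.g. `h''/h²` as `h h''/h³`.
  let p₂ : ℝ → ℝ := fun x =>
    densityTerm h x₀ v (fun y => κ * (2 * deriv h y ^ 2 - h y * deriv (deriv h) y - 1 / v)) 0 3 x +
    densityTerm h x₀ v (fun y => 3 * κ / v * deriv h y) 1 3 x +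
    densityTerm h x₀ v (fun _ => κ / v ^ 2) 2 3 x
  have hp₁ : ∀ x, HasDerivAt p (p₁ x) x := fun x => by
    rw [hpe]
    refine (hasDerivAt_densityTerm hs h0 hv (fun x => hasDerivAt_const x κ) 0 1 x).congr_deriv ?_
    simp only [p₁]
    by_cases hx : x ∈ nonvanishingInterval h x₀
    · simp only [densityTerm_of_mem hx]; push_cast; ring
    · simp only [densityTerm_of_notMem hx]; ring
  have hp₂ : ∀ x, HasDerivAt p₁ (p₂ x) x := fun x => by
    refine ((hasDerivAt_densityTerm hs h0 hv (fun x => (hd2 x).const_mul (-κ)) 0 2 x).add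
      (hasDerivAt_densityTerm hs h0 hv (fun x => hasDerivAt_const x (-κ / v)) 1 2 x)).congr_deriv ?_
    simp only [p₂]
    by_cases hx : x ∈ nonvanishingInterval h x₀
    · have hne := ne_zero_of_mem_nonvanishingInterval hx
      simp only [densityTerm_of_mem hx]; push_cast; field_simp; ring
    · simp only [densityTerm_of_notMem hx]; ring
  have hp₂c : Continuous p₂ := by
    have hcont : ∀ (w : ℝ → ℝ) (m : ℕ), ContDiff ℝ ∞ w → Continuous (densityTerm h x₀ v w m 3) :=
      fun w m hw => continuous_iff_continuousAt.2 fun x => (hasDerivAt_densityTerm hs h0 hv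
        (fun x => (hw.differentiable (by simp) x).hasDerivAt) m 3 x).continuousAt
    exact ((hcont _ 0 (by fun_prop)).add (hcont _ 1 (by fun_prop))).add (hcont _ 2 (by fun_prop))
  have hdp : deriv p = p₁ := funext fun x => (hp₁ x).deriv
  have hdp₁ : deriv p₁ = p₂ := funext fun x => (hp₂ x).deriv
  refine ⟨?_, fun x => ?_⟩
  · rw [← one_add_one_eq_two, contDiff_succ_iff_deriv]
    refine ⟨fun x => (hp₁ x).differentiableAt, by simp, ?_⟩
    rw [hdp, contDiff_one_iff_deriv, hdp₁]
    exact ⟨fun x => (hp₂ x).differentiableAt, hp₂c⟩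
  · set c := H * t ^ (2 * H - 1) with hc
    have e1 : deriv (fun y => c * (deriv h y * h y) * p y) x =
        c * ((deriv (deriv h) x * h x + deriv h x * deriv h x) * p x
          + deriv h x * h x * p₁ x) := by
      refine ((((hd2 x).mul (hd1 x)).const_mul c).mul (hp₁ x)).deriv.trans ?_
      simp only [Pi.mul_apply]
      ring
    have e2 : deriv (fun y => c * h y ^ 2 * p y) = fun x =>
        c * (2 * h x * deriv h x * p x + h x ^ 2 * p₁ x) := funext fun x => by
      refine ((((hd1 x).pow 2).const_mul c).mul (hp₁ x)).deriv.trans ?_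
      simp only [Pi.pow_apply]
      push_cast
      ring
    have e3 : iteratedDeriv 2 (fun y => c * h y ^ 2 * p y) x =
        c * ((2 * deriv h x ^ 2 + 2 * h x * deriv (deriv h) x) * p x
          + 4 * h x * deriv h x * p₁ x + h x ^ 2 * p₂ x) := by
      rw [iteratedDeriv_succ, iteratedDeriv_one, e2]
      refine ((((((hd1 x).const_mul 2).mul (hd2 x)).mul (hp₁ x)).add
        (((hd1 x).pow 2).mul (hp₂ x))).const_mul c).deriv.trans ?_
      simp only [Pi.pow_apply, Pi.mul_apply]
      push_cast
      ring
    change HasDerivAt (fun s => explicitDensity (1 / (2 * √Real.pi)) H h x₀ x s)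
      (-deriv (fun y => c * (deriv h y * h y) * p y) x +
        iteratedDeriv 2 (fun y => c * h y ^ 2 * p y) x) t
    rw [e1, e3]
    by_cases hx : x ∈ nonvanishingInterval h x₀
    · have hne := ne_zero_of_mem_nonvanishingInterval hx
      have hpow : HasDerivAt (fun s : ℝ => s ^ (2 * H)) (2 * c) t := by
        refine (Real.hasDerivAt_rpow_const (p := 2 * H) (Or.inl ht.ne')).congr_deriv ?_
        rw [hc]; ring
      have hprof := (hasDerivAt_timeProfile |h x|⁻¹ (xHat h x₀ x) hv).comp t hpow
      have hev : (fun s => explicitDensity (1 / (2 * √Real.pi)) H h x₀ x s) =ᶠ[𝓝 t]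
          (fun v => |h x|⁻¹ * ((√(2 * Real.pi * v))⁻¹ *
            Real.exp (-(xHat h x₀ x ^ 2) / (2 * v)))) ∘ fun s : ℝ => s ^ (2 * H) := by
        filter_upwards [lt_mem_nhds ht] with s hs'
        exact explicitDensity_of_mem hs' hx
      refine (hprof.congr_of_eventuallyEq hev).congr_deriv ?_
      have epx : |h x|⁻¹ * ((√(2 * Real.pi * v))⁻¹ *
            Real.exp (-(xHat h x₀ x ^ 2) / (2 * v))) = p x := (explicitDensity_of_mem ht hx).symm
      rw [epx, hpe]
      simp only [p₁, p₂, densityTerm_of_mem hx]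
      field_simp
      ring
    · have hz : (fun s => explicitDensity (1 / (2 * √Real.pi)) H h x₀ x s) = fun _ => 0 :=
        funext fun s => explicitDensity_of_notMem hx
      rw [hz, hpe]
      simp only [p₁, p₂, densityTerm_of_notMem hx]
      simpa using hasDerivAt_const t (0 : ℝ)

/-! ### The explicit density as a law -/

theorem explicitDensity_nonneg {H t : ℝ} (x : ℝ) :
    0 ≤ explicitDensity (1 / (2 * √Real.pi)) H h x₀ x t := by
  unfold explicitDensity
  exact indicator_nonneg (fun x _ => by positivity) x

/-- Change of variables along `x̂`: the preimage of `A` under the flow is the image under `x̂` of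
the part of `A` in the interval. -/
theorem withDensity_explicitDensity (hs : ContDiff ℝ ∞ h) (hb : ∃ M : ℝ, ∀ x, |h x| ≤ M)
    (h0 : h x₀ ≠ 0) {H t : ℝ} (ht : 0 < t) :
    volume.withDensity
        (fun x => ENNReal.ofReal (explicitDensity (1 / (2 * √Real.pi)) H h x₀ x t)) =
      (gaussianReal 0 1).map fun z => flow h x₀ (t ^ H * z) := by
  have hv : 0 < t ^ (2 * H) := Real.rpow_pos_of_pos ht _
  set v : ℝ≥0 := ⟨t ^ (2 * H), hv.le⟩ with hvdef
  have hv0 : v ≠ 0 := fun e => hv.ne' (congrArg NNReal.toReal e)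
  have hfc := continuous_flow hs hb h0
  have hflow : ((gaussianReal 0 1).map fun z => flow h x₀ (t ^ H * z)) =
      (gaussianReal 0 v).map (flow h x₀) := by
    have e : gaussianReal 0 v = (gaussianReal 0 1).map (fun z => t ^ H * z) := by
      rw [gaussianReal_map_const_mul, mul_zero, mul_one]
      congr 1
      ext
      change t ^ (2 * H) = (t ^ H) ^ 2
      rw [← Real.rpow_natCast (t ^ H), ← Real.rpow_mul ht.le, mul_comm]
      rfl
    rw [e, Measure.map_map hfc.measurable (by fun_prop)]
    rfl
  rw [hflow]
  have hIo := isOpen_nonvanishingInterval (x₀ := x₀) hs.continuous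
  set I := nonvanishingInterval h x₀ with hI
  ext A hA
  have himg : flow h x₀ ⁻¹' A = xHat h x₀ '' (A ∩ I) := by
    ext u
    constructor
    · intro hu
      exact ⟨flow h x₀ u, ⟨hu, flow_mem hs hb h0 u⟩, xHat_flow hs hb h0 u⟩
    · rintro ⟨x, ⟨hxA, hxI⟩, rfl⟩
      rw [mem_preimage, flow_xHat hs.continuous hxI]
      exact hxA
  have hAI : MeasurableSet (A ∩ I) := hA.inter hIo.measurableSet
  rw [Measure.map_apply hfc.measurable hA, gaussianReal_apply 0 hv0, himg,
    lintegral_image_eq_lintegral_abs_deriv_mul hAI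
      (fun x hx => (hasDerivAt_xHat hs.continuous hx.2).hasDerivWithinAt)
      ((injOn_xHat hs.continuous).mono inter_subset_right), withDensity_apply _ hA]
  have hind : ∀ x, ENNReal.ofReal (explicitDensity (1 / (2 * √Real.pi)) H h x₀ x t) =
      I.indicator (fun x => ENNReal.ofReal |1 / h x| * gaussianPDF 0 v (xHat h x₀ x)) x := by
    intro x
    by_cases hx : x ∈ I
    · rw [indicator_of_mem hx, explicitDensity_of_mem ht hx, gaussianPDF,
        ENNReal.ofReal_mul (by positivity), one_div, abs_inv, gaussianPDFReal, sub_zero]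
      rfl
    · rw [indicator_of_notMem hx, explicitDensity_of_notMem hx, ENNReal.ofReal_zero]
  simp_rw [hind]
  rw [lintegral_indicator hIo.measurableSet, Measure.restrict_restrict hIo.measurableSet,
    inter_comm]

end Density

/-! ### The main theorem -/

theorem corollary2p10 {Ω : Type*} [MeasurableSpace Ω] (P : Measure Ω) [IsProbabilityMeasure P]
    (H : ℝ) (hH : 1 / 2 < H) (hH' : H < 1)
    (B : ℝ → Ω → ℝ) (hB : IsFractionalBrownianMotion H B P)
    (T : ℝ) (hT : 0 < T) (x₀ : ℝ)
    (h : ℝ → ℝ) (hsmooth : ContDiff ℝ ∞ h) (hbdd : ∃ M : ℝ, ∀ x, |h x| ≤ M)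
    (X : ℝ → Ω → ℝ) (hX : IsSymmetricSDESolution P B h x₀ T X) :
    -- the laws of `X_t` solve the equation weakly, with initial value the Dirac mass at `x₀`
    (IsWeakPDEESolution H h T (fun t => P.map (X t)) ∧
      P.map (X 0) = Measure.dirac x₀ ∧
      ∀ g : ℝ →ᵇ ℝ, Tendsto (fun t => ∫ x, g x ∂(P.map (X t))) (𝓝[>] 0) (𝓝 (g x₀))) ∧
    -- if `h(x₀) ≠ 0`, then `X_t` has the explicit density, which solves the equation classically
    (h x₀ ≠ 0 → ∃ C₁ : ℝ, C₁ = 1 / (2 * √Real.pi) ∧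
      (∀ t > 0, ∫ x, explicitDensity C₁ H h x₀ x t = 1) ∧
      (∀ t ∈ Ioc 0 T, P.map (X t) =
        volume.withDensity (fun x => ENNReal.ofReal (explicitDensity C₁ H h x₀ x t))) ∧
      IsClassicalPDEESolution H h (explicitDensity C₁ H h x₀) ∧
      ∀ g : ℝ →ᵇ ℝ, Tendsto (fun t => ∫ x, g x * explicitDensity C₁ H h x₀ x t)
        (𝓝[>] 0) (𝓝 (g x₀))) := by
  have hH0 : 0 < H := by linarith
  have hlaw : ∀ t ∈ Icc 0 T,
      P.map (X t) = (gaussianReal 0 1).map (fun z => solutionMap h x₀ (t ^ H * z)) :=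
    fun t ht => hX.map_eq hB hH hsmooth hbdd ht
  refine ⟨⟨fun φ hφ hφc t ht => ?_, ?_, fun g => ?_⟩, fun h0 => ⟨_, rfl, ?_⟩⟩
  · beta_reduce
    rw [hlaw t (Ioo_subset_Icc_self ht)]
    refine (weakPDE_gaussian hsmooth (hasDerivAt_solutionMap hsmooth hbdd x₀) hφ hφc
      ht.1).congr_of_eventuallyEq ?_
    -- The law is known only on `[0, T]`, but differentiability at `t` is local.
    filter_upwards [Ioo_mem_nhds ht.1 ht.2] with s hs
    rw [hlaw s (Ioo_subset_Icc_self hs)]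
  · rw [Measure.map_congr (g := fun _ => x₀) hX.initial, Measure.map_const, measure_univ, one_smul]
  · have key := tendsto_integral_map_gaussianReal (continuous_solutionMap hsmooth hbdd x₀) hH0 g
    rw [solutionMap_zero hsmooth] at key
    refine key.congr' ?_
    filter_upwards [Ioo_mem_nhdsGT hT] with t ht
    rw [hlaw t (Ioo_subset_Icc_self ht)]
  · have hcl := isClassicalPDEESolution_explicitDensity hsmooth h0 H
    have hdens := fun t ht => withDensity_explicitDensity hsmooth hbdd h0 (H := H) (t := t) ht
    have hfc := continuous_flow hsmooth hbdd h0
    have hsol : solutionMap h x₀ = flow h x₀ := if_neg h0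
    -- Stated for the image measure rather than the law of `X t`, so that normalisation holds also
    -- for `t > T`.
    have hint : ∀ t > 0, ∀ g : ℝ → ℝ,
        ∫ x, g x * explicitDensity (1 / (2 * √Real.pi)) H h x₀ x t =
          ∫ x, g x ∂((gaussianReal 0 1).map fun z => flow h x₀ (t ^ H * z)) := by
      intro t ht g
      have hm : Measurable fun x => explicitDensity (1 / (2 * √Real.pi)) H h x₀ x t :=
        (hcl t ht).1.continuous.measurable
      rw [← hdens t ht, integral_withDensity_eq_integral_toReal_smul hm.ennreal_ofReal
        (ae_of_all _ fun x => ENNReal.ofReal_lt_top)]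
      congr 1
      ext x
      rw [ENNReal.toReal_ofReal (explicitDensity_nonneg x), smul_eq_mul, mul_comm]
    refine ⟨fun t ht => ?_, fun t ht => ?_, hcl, fun g => ?_⟩
    · have : IsProbabilityMeasure ((gaussianReal 0 1).map fun z => flow h x₀ (t ^ H * z)) :=
        Measure.isProbabilityMeasure_map (Continuous.aemeasurable (by fun_prop))
      simpa using hint t ht fun _ => 1
    · rw [hlaw t (Ioc_subset_Icc_self ht), hsol, hdens t ht.1]
    · have key := tendsto_integral_map_gaussianReal hfc hH0 g
      rw [flow_zero hsmooth.continuous h0] at key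
      refine key.congr' ?_
      filter_upwards [self_mem_nhdsWithin] with t ht
      exact (hint t ht g).symm
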